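/- Let $d,m\ge 1$. Let $Q=(q_{ij}):\mathbb{R}^d\to\mathbb{R}^{d\times d}$ be such that for all $i,j$ the function $q_{ij}=q_{ji}$ is bounded and continuously differentiable with bounded derivative, and suppose that there are $\eta_1,\eta_2>0$ with $$\eta_1|\xi|^2\le\langle Q(x)\xi,\xi\rangle\le\eta_2|\xi|^2\qquad\text{for all }x,\xi\in\mathbb{R}^d.$$ Let $V=(v_{ij}):\mathbb{R}^d\to\mathbb{R}^{m\times m}$ have entries $v_{ij}\in L^\infty_{\mathrm{loc}}(\mathbb{R}^d)$ and satisfy $$\operatorname{Re}\langle V(x)\xi,\xi\rangle\ge 0\qquad\text{for all }x\in\mathbb{R}^d,\ \xi\in\mathbb{C}^m.$$ For $u=(u_1,\dots,u_m)\in H^1(\mathbb{R}^d;\mathbb{C}^m)$ let $\mathcal{A}u=\operatorname{div}(Q\nabla u)-Vu$ in the sense of distributions, where the divergence acts componentwise, i.e. for all $\varphi\in C_c^\infty(\mathbb{R}^d)$ and $k=1,\dots,m$ $$\langle(\mathcal{A}u)_k,\varphi\rangle=-\int_{\mathbb{R}^d}\sum_{i,j=1}^d q_{ij}\,\partial_j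 u_k\,\partial_i\varphi\,dx-\int_{\mathbb{R}^d}(Vu)_k\,\varphi\,dx .$$ Let $A$ be the operator on $L^2(\mathbb{R}^d;\mathbb{C}^m)$ with $$D(A)=\{u\in H^1(\mathbb{R}^d;\mathbb{C}^m):\ \mathcal{A}u\in L^2(\mathbb{R}^d;\mathbb{C}^m)\},\qquad Au=\mathcal{A}u .$$ Then $A$ generates a $C_0$-semigroup of contractions on $L^2(\mathbb{R}^d;\mathbb{C}^m)$: there is a strongly continuous semigroup $(T(t))_{t\ge0}$ of bounded linear operators on $L^2(\mathbb{R}^d;\mathbb{C}^m)$ with $\|T(t)\|\le 1$ for all $t\ge 0$ whose generator, including its domain, is $A$. -/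

import Mathlib

open MeasureTheory Filter Topology
open scoped NNReal ENNReal Distributions LineDeriv

noncomputable section

/-! ### Strongly continuous semigroups and their generators -/

section Semigroups

variable {X : Type*} [NormedAddCommGroup X] [NormedSpace ℂ X]

/-- A `C₀`-semigroup (strongly continuous one-parameter semigroup) of bounded operators. -/
structure IsC0Semigroup (T : ℝ≥0 → X →L[ℂ] X) : Prop where
  map_zero : T 0 = ContinuousLinearMap.id ℂ X
  map_add : ∀ s t, T (s + t) = (T s).comp (T t)
  continuous_orbit : ∀ x, Continuous fun t => T t x

/-- `y` is the right derivative at `t = 0` of the orbit `t ↦ T t x`. -/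
def HasOrbitDeriv (T : ℝ≥0 → X →L[ℂ] X) (x y : X) : Prop :=
  Tendsto (fun t : ℝ≥0 => (t : ℝ)⁻¹ • (T t x - x)) (𝓝[>] 0) (𝓝 y)

lemma HasOrbitDeriv.unique {T : ℝ≥0 → X →L[ℂ] X} {x y z : X}
    (h : HasOrbitDeriv T x y) (h' : HasOrbitDeriv T x z) : y = z :=
  tendsto_nhds_unique h h'

lemma HasOrbitDeriv.add {T : ℝ≥0 → X →L[ℂ] X} {x y x' y' : X}
    (h : HasOrbitDeriv T x y) (h' : HasOrbitDeriv T x' y') :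
    HasOrbitDeriv T (x + x') (y + y') := by
  refine (Tendsto.add h h').congr fun t => ?_
  rw [map_add, ← smul_add]
  congr 1
  abel

lemma HasOrbitDeriv.smul {T : ℝ≥0 → X →L[ℂ] X} {x y : X} (c : ℂ)
    (h : HasOrbitDeriv T x y) : HasOrbitDeriv T (c • x) (c • y) := by
  refine (Tendsto.const_smul h c).congr fun t => ?_
  rw [map_smul, ← smul_sub, smul_comm]

/-- The generator of `T`: its domain consists of all `x` for which the orbit of `x` is
right differentiable at `0`, and it maps `x` to that derivative. -/
def semigroupGenerator (T : ℝ≥0 → X →L[ℂ] X) : X →ₗ.[ℂ] X where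
  domain :=
    { carrier := {x | ∃ y, HasOrbitDeriv T x y}
      zero_mem' := ⟨0, by simp [HasOrbitDeriv]⟩
      add_mem' := fun ⟨_, h⟩ ⟨_, h'⟩ => ⟨_, h.add h'⟩
      smul_mem' := fun c _ ⟨_, h⟩ => ⟨_, h.smul c⟩ }
  toFun :=
    { toFun := fun x => x.2.choose
      map_add' := fun x x' =>
        (x + x').2.choose_spec.unique (x.2.choose_spec.add x'.2.choose_spec)
      map_smul' := fun c x => (c • x).2.choose_spec.unique (x.2.choose_spec.smul c) }

end Semigroups

/-! ### Function spaces on `ℝ^d` -/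

/-- The space `L²(ℝ^d; ℂ^m)`, where `ℝ^d` carries Lebesgue measure and `ℂ^m` the Euclidean norm. -/
abbrev LTwo (d m : ℕ) : Type :=
  Lp (EuclideanSpace ℂ (Fin m)) 2 (volume : Measure (EuclideanSpace ℝ (Fin d)))

/-- `f ∈ L^∞_loc(ℝ^d)`: the truncation of `f` to every ball around the origin is in `L^∞`. -/
def MemLinftyLoc {d : ℕ} (f : EuclideanSpace ℝ (Fin d) → ℝ) : Prop :=
  ∀ r : ℝ, 0 < r → MemLp ((Metric.closedBall 0 r).indicator f) ∞ volume

/-- The space of `ℂ^m`-valued distributions on `ℝ^d`. -/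
abbrev VDistribution (d m : ℕ) : Type :=
  𝓓'((⊤ : TopologicalSpace.Opens (EuclideanSpace ℝ (Fin d))), EuclideanSpace ℂ (Fin m))

/-- The regular distribution `φ ↦ ∫ φ f` of a locally integrable function `f`. -/
def regularDistribution {d m : ℕ} (f : EuclideanSpace ℝ (Fin d) → EuclideanSpace ℂ (Fin m)) :
    VDistribution d m :=
  TestFunction.integralAgainstBilinCLM (ContinuousLinearMap.lsmul ℝ ℝ) volume f

lemma regularDistribution_apply {d m : ℕ}
    {f : EuclideanSpace ℝ (Fin d) → EuclideanSpace ℂ (Fin m)} (hf : LocallyIntegrable f volume)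
    (φ : 𝓓((⊤ : TopologicalSpace.Opens (EuclideanSpace ℝ (Fin d))), ℝ)) :
    regularDistribution f φ = ∫ x, φ x • f x :=
  TestFunction.integralAgainstBilinCLM_eq_integral (hf.locallyIntegrableOn _)

lemma regularDistribution_add {d m : ℕ}
    {f g : EuclideanSpace ℝ (Fin d) → EuclideanSpace ℂ (Fin m)}
    (hf : LocallyIntegrable f volume) (hg : LocallyIntegrable g volume) :
    regularDistribution (f + g) = regularDistribution f + regularDistribution g := by
  ext1 φ
  rw [add_apply, regularDistribution_apply (hf.add hg),
    regularDistribution_apply hf, regularDistribution_apply hg]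
  simp only [Pi.add_apply, smul_add]
  exact integral_add
    (φ.integrable_bilin (ContinuousLinearMap.lsmul ℝ ℝ) (hf.locallyIntegrableOn _))
    (φ.integrable_bilin (ContinuousLinearMap.lsmul ℝ ℝ) (hg.locallyIntegrableOn _))

lemma regularDistribution_smul {d m : ℕ} (c : ℂ)
    {f : EuclideanSpace ℝ (Fin d) → EuclideanSpace ℂ (Fin m)}
    (hf : LocallyIntegrable f volume) :
    regularDistribution (c • f) = c • regularDistribution f := by
  ext1 φ
  rw [smul_apply, regularDistribution_apply (hf.smul c),
    regularDistribution_apply hf, ← integral_smul]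
  exact integral_congr_ae (.of_forall fun x => smul_comm (φ x) c (f x))

lemma regularDistribution_congr {d m : ℕ}
    {f g : EuclideanSpace ℝ (Fin d) → EuclideanSpace ℂ (Fin m)}
    (hf : LocallyIntegrable f volume) (h : f =ᵐ[volume] g) :
    regularDistribution f = regularDistribution g := by
  ext1 φ
  rw [regularDistribution_apply hf, regularDistribution_apply ((locallyIntegrable_congr h).1 hf)]
  exact integral_congr_ae (h.mono fun x hx => by simp only [hx])

lemma LTwo.locallyIntegrable {d m : ℕ} (u : LTwo d m) : LocallyIntegrable u volume :=
  (Lp.memLp u).locallyIntegrable one_le_two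

lemma LTwo.regularDistribution_add {d m : ℕ} (u v : LTwo d m) :
    regularDistribution ⇑(u + v) = regularDistribution u + regularDistribution v := by
  rw [regularDistribution_congr (u + v).locallyIntegrable (Lp.coeFn_add u v),
    _root_.regularDistribution_add u.locallyIntegrable v.locallyIntegrable]

lemma LTwo.regularDistribution_smul {d m : ℕ} (c : ℂ) (u : LTwo d m) :
    regularDistribution ⇑(c • u) = c • regularDistribution u := by
  rw [regularDistribution_congr (c • u).locallyIntegrable (Lp.coeFn_smul c u),
    _root_.regularDistribution_smul c u.locallyIntegrable]

lemma LTwo.regularDistribution_zero {d m : ℕ} :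
    regularDistribution ⇑(0 : LTwo d m) = 0 := by
  have h := LTwo.regularDistribution_add (0 : LTwo d m) 0
  rw [add_zero] at h
  exact left_eq_add.1 h

lemma LTwo.regularDistribution_injective {d m : ℕ} {u v : LTwo d m}
    (h : regularDistribution u = regularDistribution v) : u = v := by
  refine Lp.ext (ae_eq_of_integral_contDiff_smul_eq u.locallyIntegrable v.locallyIntegrable
    fun φ hφ hφ' => ?_)
  have := DFunLike.congr_fun h (⟨φ, hφ, hφ', fun _ _ => trivial⟩ :
    𝓓((⊤ : TopologicalSpace.Opens (EuclideanSpace ℝ (Fin d))), ℝ))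
  rwa [regularDistribution_apply u.locallyIntegrable,
    regularDistribution_apply v.locallyIntegrable] at this

/-- The `i`-th distributional partial derivative `∂_i S`. -/
def distPartial {d m : ℕ} (i : Fin d) (S : VDistribution d m) : VDistribution d m :=
  ∂_{EuclideanSpace.single i (1 : ℝ)} S

lemma distPartial_add {d m : ℕ} (i : Fin d) (S S' : VDistribution d m) :
    distPartial i (S + S') = distPartial i S + distPartial i S' :=
  map_add (Distribution.lineDerivCLM _) S S'

lemma distPartial_smul {d m : ℕ} (i : Fin d) (c : ℂ) (S : VDistribution d m) :
    distPartial i (c • S) = c • distPartial i S := by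
  ext1 φ
  simp [distPartial]

/-- The Sobolev space `H¹(ℝ^d; ℂ^m) = W^{1,2}(ℝ^d; ℂ^m)`: all `u ∈ L²` whose first order
distributional partial derivatives belong to `L²`. -/
def HOne (d m : ℕ) : Submodule ℂ (LTwo d m) where
  carrier := {u | ∀ i, ∃ g : LTwo d m, distPartial i (regularDistribution u) =
    regularDistribution g}
  zero_mem' := fun i => ⟨0, by
    rw [LTwo.regularDistribution_zero]
    exact map_zero (Distribution.lineDerivCLM _)⟩
  add_mem' := fun {u v} hu hv i => by
    obtain ⟨g, hg⟩ := hu i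
    obtain ⟨g', hg'⟩ := hv i
    exact ⟨g + g', by
      rw [LTwo.regularDistribution_add, LTwo.regularDistribution_add, distPartial_add, hg, hg']⟩
  smul_mem' := fun c u hu i => by
    obtain ⟨g, hg⟩ := hu i
    exact ⟨c • g, by
      rw [LTwo.regularDistribution_smul, LTwo.regularDistribution_smul, distPartial_smul, hg]⟩

/-- The weak partial derivative `∂_i u ∈ L²` of `u ∈ H¹`. -/
def weakPartial {d m : ℕ} (i : Fin d) : HOne d m →ₗ[ℂ] LTwo d m where
  toFun u := (u.2 i).choose
  map_add' u v := LTwo.regularDistribution_injective <| by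
    rw [← ((u + v).2 i).choose_spec, LTwo.regularDistribution_add, ← (u.2 i).choose_spec,
      ← (v.2 i).choose_spec, ← distPartial_add, ← LTwo.regularDistribution_add]
    rfl
  map_smul' c u := LTwo.regularDistribution_injective <| by
    rw [← ((c • u).2 i).choose_spec, RingHom.id_apply, LTwo.regularDistribution_smul,
      ← (u.2 i).choose_spec, ← distPartial_smul, ← LTwo.regularDistribution_smul]
    rfl

lemma regularDistribution_weakPartial {d m : ℕ} (i : Fin d) (u : HOne d m) :
    regularDistribution (weakPartial i u) = distPartial i (regularDistribution (u : LTwo d m)) :=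
  (u.2 i).choose_spec.symm

/-! ### The vector-valued Schrödinger operator -/

/-- The standing hypotheses: `Q` is symmetric and uniformly elliptic with bounded `C¹` entries
whose derivatives are bounded; `V` has entries in `L^∞_loc` and is pointwise accretive. -/
structure SchrodingerHypotheses {d m : ℕ}
    (Q : EuclideanSpace ℝ (Fin d) → Matrix (Fin d) (Fin d) ℝ)
    (V : EuclideanSpace ℝ (Fin d) → Matrix (Fin m) (Fin m) ℝ) : Prop where
  symm : ∀ x i j, Q x i j = Q x j i
  contDiff : ∀ i j, ContDiff ℝ 1 fun x => Q x i j
  bounded : ∀ i j, ∃ C : ℝ, ∀ x, |Q x i j| ≤ C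
  bounded_fderiv : ∀ i j, ∃ C : ℝ, ∀ x, ‖fderiv ℝ (fun y => Q y i j) x‖ ≤ C
  elliptic : ∃ η₁ η₂ : ℝ, 0 < η₁ ∧ 0 < η₂ ∧ ∀ x ξ : EuclideanSpace ℝ (Fin d),
    η₁ * ‖ξ‖ ^ 2 ≤ ∑ i, ∑ j, Q x i j * ξ i * ξ j ∧
    ∑ i, ∑ j, Q x i j * ξ i * ξ j ≤ η₂ * ‖ξ‖ ^ 2
  locallyBounded : ∀ i j, MemLinftyLoc fun x => V x i j
  accretive : ∀ (x : EuclideanSpace ℝ (Fin d)) (ξ : EuclideanSpace ℂ (Fin m)),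
    0 ≤ (∑ i, ∑ j, (V x i j : ℂ) * ξ j * (starRingEnd ℂ) (ξ i)).re

/-- The `i`-th component `∑ j, q_{ij} ∂_j u` of the flux `Q∇u`, a `ℂ^m`-valued function. -/
def flux {d m : ℕ} (Q : EuclideanSpace ℝ (Fin d) → Matrix (Fin d) (Fin d) ℝ) (u : HOne d m)
    (i : Fin d) : EuclideanSpace ℝ (Fin d) → EuclideanSpace ℂ (Fin m) :=
  fun x => ∑ j, Q x i j • weakPartial j u x

/-- The distribution `Δ_Q u = div (Q∇u)`, where `div (Q∇u)` is taken componentwise in `u`. -/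
def deltaQ {d m : ℕ} (Q : EuclideanSpace ℝ (Fin d) → Matrix (Fin d) (Fin d) ℝ) (u : HOne d m) :
    VDistribution d m :=
  ∑ i, distPartial i (regularDistribution (flux Q u i))

/-- The function `x ↦ V(x) u(x)`. -/
def potentialMul {d m : ℕ} (V : EuclideanSpace ℝ (Fin d) → Matrix (Fin m) (Fin m) ℝ)
    (u : EuclideanSpace ℝ (Fin d) → EuclideanSpace ℂ (Fin m)) :
    EuclideanSpace ℝ (Fin d) → EuclideanSpace ℂ (Fin m) :=
  fun x => WithLp.toLp 2 fun i => ∑ j, (V x i j : ℂ) * u x j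

/-- The distribution `𝒜u = div (Q∇u) - Vu` for `u ∈ H¹`. -/
def schrodingerDistribution {d m : ℕ}
    (Q : EuclideanSpace ℝ (Fin d) → Matrix (Fin d) (Fin d) ℝ)
    (V : EuclideanSpace ℝ (Fin d) → Matrix (Fin m) (Fin m) ℝ) (u : HOne d m) :
    VDistribution d m :=
  deltaQ Q u - regularDistribution (potentialMul V (u : LTwo d m))

section Linearity

variable {d m : ℕ} {Q : EuclideanSpace ℝ (Fin d) → Matrix (Fin d) (Fin d) ℝ}
  {V : EuclideanSpace ℝ (Fin d) → Matrix (Fin m) (Fin m) ℝ}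

lemma SchrodingerHypotheses.flux_locallyIntegrable (h : SchrodingerHypotheses Q V)
    (u : HOne d m) (i : Fin d) : LocallyIntegrable (flux Q u i) volume := by
  refine locallyIntegrable_finsetSum (f := fun j x => Q x i j • weakPartial j u x)
    Finset.univ fun j _ => ?_
  exact (weakPartial j u).locallyIntegrable.continuous_smul (h.contDiff i j).continuous

/-- The defining pairing `⟨Δ_Q u, φ⟩ = -∫ ⟨∇u, ∇φ⟩_Q`. -/
lemma SchrodingerHypotheses.deltaQ_apply (h : SchrodingerHypotheses Q V) (u : HOne d m)
    (φ : 𝓓((⊤ : TopologicalSpace.Opens (EuclideanSpace ℝ (Fin d))), ℝ)) :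
    deltaQ Q u φ = -∫ x, ∑ i, ∑ j, (Q x i j *
      fderiv ℝ φ x (EuclideanSpace.single i 1)) • weakPartial j u x := by
  have key : ∀ i, distPartial i (regularDistribution (flux Q u i)) φ =
      -∫ x, fderiv ℝ φ x (EuclideanSpace.single i 1) • flux Q u i x := fun i => by
    rw [distPartial, Distribution.lineDerivOp_apply_apply, map_neg,
      regularDistribution_apply (h.flux_locallyIntegrable u i)]
    rfl
  have hint : ∀ i, Integrable fun x =>
      fderiv ℝ φ x (EuclideanSpace.single i 1) • flux Q u i x := fun i =>
    (∂_{EuclideanSpace.single i (1 : ℝ)} φ).integrable_bilin (ContinuousLinearMap.lsmul ℝ ℝ)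
      ((h.flux_locallyIntegrable u i).locallyIntegrableOn _)
  rw [deltaQ, _root_.sum_apply]
  simp only [key]
  rw [Finset.sum_neg_distrib, ← integral_finsetSum _ fun i _ => hint i]
  simp only [flux, Finset.smul_sum, smul_smul, mul_comm]

lemma SchrodingerHypotheses.potentialMul_locallyIntegrable (h : SchrodingerHypotheses Q V)
    (u : LTwo d m) : LocallyIntegrable (potentialMul V u) volume := by
  rw [locallyIntegrable_iff]
  intro K hK
  obtain ⟨r, hr, hKr⟩ := hK.isBounded.subset_closedBall_lt 0 0
  refine IntegrableOn.mono_set ?_ hKr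
  refine Integrable.of_eval_piLp fun i => ?_
  refine integrable_finsetSum (f := fun j x => (V x i j : ℂ) * u x j) Finset.univ fun j _ => ?_
  have hV := h.locallyBounded i j r hr
  rw [memLp_indicator_iff_restrict Metric.isClosed_closedBall.measurableSet] at hV
  have hu : Integrable (fun x => u x j) (volume.restrict (Metric.closedBall 0 r)) :=
    Integrable.eval_piLp
      (u.locallyIntegrable.integrableOn_isCompact (isCompact_closedBall 0 r)) j
  rw [← memLp_one_iff_integrable] at hu ⊢
  exact hu.mul hV.ofReal

lemma potentialMul_add (u v : EuclideanSpace ℝ (Fin d) → EuclideanSpace ℂ (Fin m)) :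
    potentialMul V (u + v) = potentialMul V u + potentialMul V v := by
  ext x i
  simp [potentialMul, mul_add, Finset.sum_add_distrib]

lemma potentialMul_smul (c : ℂ) (u : EuclideanSpace ℝ (Fin d) → EuclideanSpace ℂ (Fin m)) :
    potentialMul V (c • u) = c • potentialMul V u := by
  ext x i
  simp [potentialMul, Finset.mul_sum, mul_left_comm]

lemma potentialMul_congr {u v : EuclideanSpace ℝ (Fin d) → EuclideanSpace ℂ (Fin m)}
    (huv : u =ᵐ[volume] v) : potentialMul V u =ᵐ[volume] potentialMul V v :=
  huv.mono fun x hx => by simp [potentialMul, hx]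

lemma flux_add (u v : HOne d m) (i : Fin d) :
    flux Q (u + v) i =ᵐ[volume] flux Q u i + flux Q v i := by
  have : ∀ᵐ x, ∀ j, weakPartial j (u + v) x = weakPartial j u x + weakPartial j v x :=
    ae_all_iff.2 fun j => by rw [map_add]; exact Lp.coeFn_add _ _
  filter_upwards [this] with x hx
  simp only [flux, Pi.add_apply, hx, smul_add, Finset.sum_add_distrib]

lemma flux_smul (c : ℂ) (u : HOne d m) (i : Fin d) :
    flux Q (c • u) i =ᵐ[volume] c • flux Q u i := by
  have : ∀ᵐ x, ∀ j, weakPartial j (c • u) x = c • weakPartial j u x :=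
    ae_all_iff.2 fun j => by rw [map_smul]; exact Lp.coeFn_smul _ _
  filter_upwards [this] with x hx
  simp only [flux, Pi.smul_apply, hx, Finset.smul_sum, smul_comm c]

lemma SchrodingerHypotheses.schrodingerDistribution_add (h : SchrodingerHypotheses Q V)
    (u v : HOne d m) : schrodingerDistribution Q V (u + v) =
      schrodingerDistribution Q V u + schrodingerDistribution Q V v := by
  have h1 : deltaQ Q (u + v) = deltaQ Q u + deltaQ Q v := by
    simp only [deltaQ, ← Finset.sum_add_distrib]
    refine Finset.sum_congr rfl fun i _ => ?_
    rw [regularDistribution_congr (h.flux_locallyIntegrable (u + v) i) (flux_add u v i),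
      regularDistribution_add (h.flux_locallyIntegrable u i) (h.flux_locallyIntegrable v i),
      distPartial_add]
  have h2 : regularDistribution (potentialMul V ((u + v : HOne d m) : LTwo d m)) =
      regularDistribution (potentialMul V (u : LTwo d m)) +
        regularDistribution (potentialMul V (v : LTwo d m)) := by
    rw [Submodule.coe_add, regularDistribution_congr (h.potentialMul_locallyIntegrable _)
      (potentialMul_congr (Lp.coeFn_add (u : LTwo d m) (v : LTwo d m))), potentialMul_add,
      regularDistribution_add (h.potentialMul_locallyIntegrable _)
        (h.potentialMul_locallyIntegrable _)]
  rw [schrodingerDistribution, schrodingerDistribution, schrodingerDistribution, h1, h2]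
  abel

lemma SchrodingerHypotheses.schrodingerDistribution_smul (h : SchrodingerHypotheses Q V)
    (c : ℂ) (u : HOne d m) : schrodingerDistribution Q V (c • u) =
      c • schrodingerDistribution Q V u := by
  have h1 : deltaQ Q (c • u) = c • deltaQ Q u := by
    simp only [deltaQ, Finset.smul_sum]
    refine Finset.sum_congr rfl fun i _ => ?_
    rw [regularDistribution_congr (h.flux_locallyIntegrable (c • u) i) (flux_smul c u i),
      regularDistribution_smul c (h.flux_locallyIntegrable u i), distPartial_smul]
  have h2 : regularDistribution (potentialMul V ((c • u : HOne d m) : LTwo d m)) =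
      c • regularDistribution (potentialMul V (u : LTwo d m)) := by
    rw [Submodule.coe_smul, regularDistribution_congr (h.potentialMul_locallyIntegrable _)
      (potentialMul_congr (Lp.coeFn_smul c (u : LTwo d m))), potentialMul_smul,
      regularDistribution_smul c (h.potentialMul_locallyIntegrable _)]
  rw [schrodingerDistribution, schrodingerDistribution, h1, h2, smul_sub]

/-- `u ∈ H¹` and the distribution `𝒜u` is (given by the function) `f ∈ L²`. -/
def IsRealization (Q : EuclideanSpace ℝ (Fin d) → Matrix (Fin d) (Fin d) ℝ)
    (V : EuclideanSpace ℝ (Fin d) → Matrix (Fin m) (Fin m) ℝ) (u f : LTwo d m) : Prop :=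
  ∃ hu : u ∈ HOne d m, schrodingerDistribution Q V ⟨u, hu⟩ = regularDistribution f

lemma IsRealization.unique {u f g : LTwo d m} (hf : IsRealization Q V u f)
    (hg : IsRealization Q V u g) : f = g :=
  LTwo.regularDistribution_injective (hf.choose_spec.symm.trans hg.choose_spec)

lemma IsRealization.add {u f v g : LTwo d m} (h : SchrodingerHypotheses Q V)
    (hf : IsRealization Q V u f) (hg : IsRealization Q V v g) :
    IsRealization Q V (u + v) (f + g) := by
  obtain ⟨hu, hf⟩ := hf
  obtain ⟨hv, hg⟩ := hg
  refine ⟨add_mem hu hv, ?_⟩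
  rw [LTwo.regularDistribution_add, ← hf, ← hg]
  exact h.schrodingerDistribution_add ⟨u, hu⟩ ⟨v, hv⟩

lemma IsRealization.smul {u f : LTwo d m} (h : SchrodingerHypotheses Q V) (c : ℂ)
    (hf : IsRealization Q V u f) : IsRealization Q V (c • u) (c • f) := by
  obtain ⟨hu, hf⟩ := hf
  refine ⟨Submodule.smul_mem _ c hu, ?_⟩
  rw [LTwo.regularDistribution_smul, ← hf]
  exact h.schrodingerDistribution_smul c ⟨u, hu⟩

lemma IsRealization.zero (h : SchrodingerHypotheses Q V) :
    IsRealization Q V (0 : LTwo d m) 0 := by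
  refine ⟨zero_mem _, ?_⟩
  have h1 := h.schrodingerDistribution_add 0 0
  rw [add_zero] at h1
  rw [LTwo.regularDistribution_zero]
  exact left_eq_add.1 h1

end Linearity

/-- The realization `A` of `𝒜 = div (Q∇·) - V` in `L²(ℝ^d; ℂ^m)`, with domain
`D(A) = {u ∈ H¹(ℝ^d; ℂ^m) : 𝒜u ∈ L²(ℝ^d; ℂ^m)}` and `A u = 𝒜u`. -/
def schrodingerOperator {d m : ℕ} (Q : EuclideanSpace ℝ (Fin d) → Matrix (Fin d) (Fin d) ℝ)
    (V : EuclideanSpace ℝ (Fin d) → Matrix (Fin m) (Fin m) ℝ)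
    (h : SchrodingerHypotheses Q V) : LTwo d m →ₗ.[ℂ] LTwo d m where
  domain :=
    { carrier := {u | ∃ f, IsRealization Q V u f}
      zero_mem' := ⟨0, .zero h⟩
      add_mem' := fun ⟨_, hf⟩ ⟨_, hg⟩ => ⟨_, hf.add h hg⟩
      smul_mem' := fun c _ ⟨_, hf⟩ => ⟨_, hf.smul h c⟩ }
  toFun :=
    { toFun := fun u => u.2.choose
      map_add' := fun u v => (u + v).2.choose_spec.unique (u.2.choose_spec.add h v.2.choose_spec)
      map_smul' := fun c u => (c • u).2.choose_spec.unique (u.2.choose_spec.smul h c) }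

end

/-! By the Lumer–Phillips theorem it is enough that `A` is dissipative and that `c - A` is onto for
every `c > 0`. This Hilbert space criterion, `LinearPMap.exists_contractionSemigroup`, is proved by
Yosida approximation: the bounded operators `c²R - c` are dissipative, commute, and converge to `A`
on its dense domain, so their exponentials converge to a contraction semigroup whose generator
extends `A`. A dissipative operator cannot properly extend one for which `1 - A` is onto, so the
generator is `A`.

For the Schrödinger operator the obstacle is that `V` is only locally bounded. The form `∫ ⟨Vu, φ⟩`
need not be bounded on `H¹ × H¹`, so Lax–Milgram does not apply directly, and an element `u` of the
domain cannot simply be used as a test function.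

Surjectivity (`exists_isRealization`) comes from Lions' lemma `exists_inner_eq_of_coercive`, which
asks for coercivity on test functions only. For compactly supported `φ` the function `Vᵀφ` is in
`L²`, so the form is represented there by an honest vector; ellipticity and accretivity make it
coercive.

Dissipativity (`dissipative`) comes from multiplying the equation `𝒜u = f` by a cutoff `ζ`. Each
term is then in `L²`, and the resulting divergence relation may be paired with `u` itself because
test functions are dense in `H¹` (`IsWeakDiv.inner_eq_zero`). The terms with `Q` and `V` have a sign
(`cutoff_identity`), and as `ζ → 1` with bounded gradients the commutator term `∇ζ · Q∇u`
disappears. The density is a Fourier argument: an element of `H¹` orthogonal to all test functions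
satisfies `Δw = w`, hence is zero. -/

/-! ### Generation of contraction semigroups on Hilbert spaces -/

section Generation

variable {X : Type*} [NormedAddCommGroup X] [InnerProductSpace ℂ X]

/-! ### Resolvents of dissipative operators and their Yosida approximations. -/

section Resolvent

variable {A : X →ₗ.[ℂ] X}

/-- `R` is the bounded inverse of `c - A`, with `c‖R‖ ≤ 1`. -/
structure IsContractiveResolvent (A : X →ₗ.[ℂ] X) (c : ℝ) (R : X →L[ℂ] X) : Prop where
  pos : 0 < c
  mem : ∀ f, R f ∈ A.domain
  right_inv : ∀ f, (c : ℂ) • R f - A ⟨R f, mem f⟩ = f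
  left_inv : ∀ x : A.domain, R ((c : ℂ) • (x : X) - A x) = x
  norm_le : ∀ f, c * ‖R f‖ ≤ ‖f‖

/-- Pair `cx - Ax` with `x`: dissipativity gives a real part of at least `c‖x‖²`, and Cauchy–Schwarz
allows a factor `‖x‖` to be cancelled. This gives both injectivity of `c - A` and the resolvent
bound. -/
lemma LinearPMap.mul_norm_le_of_dissipative (hA : ∀ x : A.domain, (inner ℂ (A x) (x : X)).re ≤ 0)
    (c : ℝ) (x : A.domain) : c * ‖(x : X)‖ ≤ ‖(c : ℂ) • (x : X) - A x‖ := by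
  rcases eq_or_ne (x : X) 0 with h0 | h0
  · simp [h0]
  have h1 : (inner ℂ ((c : ℂ) • (x : X) - A x) (x : X)).re =
      c * ‖(x : X)‖ ^ 2 - (inner ℂ (A x) (x : X)).re := by
    rw [inner_sub_left, inner_smul_left, inner_self_eq_norm_sq_to_K, Complex.sub_re,
      Complex.conj_ofReal, Complex.re_ofReal_mul]
    norm_cast
  have h2 := (Complex.re_le_norm _).trans
    (norm_inner_le_norm (𝕜 := ℂ) ((c : ℂ) • (x : X) - A x) (x : X))
  have h3 := hA x
  have h4 : 0 < ‖(x : X)‖ := norm_pos_iff.2 h0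
  refine le_of_mul_le_mul_right ?_ h4
  nlinarith

lemma LinearPMap.exists_isContractiveResolvent
    (hA : ∀ x : A.domain, (inner ℂ (A x) (x : X)).re ≤ 0) {c : ℝ} (hc : 0 < c)
    (hs : ∀ f, ∃ x : A.domain, (c : ℂ) • (x : X) - A x = f) :
    ∃ R, IsContractiveResolvent A c R := by
  have hinj : ∀ x y : A.domain, (c : ℂ) • (x : X) - A x = (c : ℂ) • (y : X) - A y → x = y :=
    fun x y h => by
      have h1 := mul_norm_le_of_dissipative hA c (x - y)
      rw [LinearPMap.map_sub, Submodule.coe_sub, smul_sub, sub_sub_sub_comm, h, sub_self,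
        norm_zero] at h1
      have h2 : ‖(x : X) - y‖ ≤ 0 := nonpos_of_mul_nonpos_right h1 hc
      exact Subtype.ext (sub_eq_zero.1 (norm_le_zero_iff.1 h2))
  choose r hr using hs
  let R : X →ₗ[ℂ] X :=
    { toFun := fun f => r f
      map_add' := fun f g => by
        have : r (f + g) = r f + r g := hinj _ _ <| by
          rw [hr, LinearPMap.map_add, Submodule.coe_add, smul_add, add_sub_add_comm, hr, hr]
        rw [this, Submodule.coe_add]
      map_smul' := fun a f => by
        have : r (a • f) = a • r f := hinj _ _ <| by
          rw [hr, LinearPMap.map_smul, Submodule.coe_smul, smul_comm, ← smul_sub, hr]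
        rw [this, Submodule.coe_smul, RingHom.id_apply] }
  have hbd : ∀ f, c * ‖R f‖ ≤ ‖f‖ := fun f =>
    (mul_norm_le_of_dissipative hA c (r f)).trans_eq (by rw [hr])
  refine ⟨R.mkContinuous c⁻¹ fun f => ?_, hc, fun f => (r f).2, fun f => hr f,
    fun x => congrArg Subtype.val (hinj _ _ (hr _)), hbd⟩
  rw [inv_mul_eq_div, le_div_iff₀ hc, mul_comm]
  exact hbd f

namespace IsContractiveResolvent

variable {c c' : ℝ} {R R' : X →L[ℂ] X}

lemma map_eq (h : IsContractiveResolvent A c R) (f : X) :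
    A ⟨R f, h.mem f⟩ = (c : ℂ) • R f - f := by
  rw [eq_sub_iff_add_eq, add_comm, ← eq_sub_iff_add_eq]
  exact (h.right_inv f).symm

lemma apply_map (h : IsContractiveResolvent A c R) (x : A.domain) :
    R (A x) = (c : ℂ) • R x - x := by
  rw [eq_sub_iff_add_eq, add_comm, ← eq_sub_iff_add_eq, ← map_smul, ← map_sub]
  exact (h.left_inv x).symm

/-- On the domain, `A` commutes with `R`, so `(c' - A) R R' f = R (c' - A) R' f = R f`; applying
`R'` gives the claim. -/
lemma commute (h : IsContractiveResolvent A c R) (h' : IsContractiveResolvent A c' R') :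
    Commute R R' := by
  refine ContinuousLinearMap.ext fun f => ?_
  have h1 := h'.left_inv ⟨R (R' f), h.mem _⟩
  have h2 : (c' : ℂ) • R (R' f) - A ⟨R (R' f), h.mem _⟩ = R f := by
    rw [h.map_eq]
    have h3 := h.apply_map ⟨R' f, h'.mem f⟩
    rw [h'.map_eq, map_sub, map_smul] at h3
    simp only at h3
    rw [← h3]
    abel
  simp only [h2] at h1
  exact h1.symm

/-- The Yosida approximation `c² R - c` of `A`. -/
def yosida (c : ℝ) (R : X →L[ℂ] X) : X →L[ℂ] X :=
  (c : ℂ) • ((c : ℂ) • R - ContinuousLinearMap.id ℂ X)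

lemma yosida_apply (c : ℝ) (R : X →L[ℂ] X) (f : X) :
    yosida c R f = (c : ℂ) • ((c : ℂ) • R f - f) := rfl

lemma commute_yosida (h : IsContractiveResolvent A c R) (h' : IsContractiveResolvent A c' R') :
    Commute (yosida c R) (yosida c' R') := by
  have h1 : Commute R R' := h.commute h'
  have h2 : Commute ((c : ℂ) • R - 1) ((c' : ℂ) • R' - 1) :=
    ((((h1.smul_left _).smul_right _).sub_left (Commute.one_left _))).sub_right
      (Commute.one_right _)
  exact (h2.smul_left _).smul_right _

/-- The approximation is `c A R`. With `y = A R f` and `f = cRf - y`, the real part equals `c (c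
Re⟨y, Rf⟩ - ‖y‖²)`, and both contributions are nonpositive. -/
lemma yosida_dissipative (h : IsContractiveResolvent A c R)
    (hA : ∀ x : A.domain, (inner ℂ (A x) (x : X)).re ≤ 0) (f : X) :
    (inner ℂ (yosida c R f) f).re ≤ 0 := by
  rw [yosida_apply, ← h.map_eq]
  set y := A ⟨R f, h.mem f⟩ with hy
  have h1 : f = (c : ℂ) • R f - y := (h.right_inv f).symm
  have h2 := hA ⟨R f, h.mem f⟩
  have h3 : (inner ℂ ((c : ℂ) • y) f).re = c * (c * (inner ℂ y (R f)).re - ‖y‖ ^ 2) := by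
    conv_lhs => rw [h1]
    rw [inner_smul_left, inner_sub_right, inner_smul_right, inner_self_eq_norm_sq_to_K,
      Complex.conj_ofReal, Complex.re_ofReal_mul, Complex.sub_re, Complex.re_ofReal_mul]
    norm_cast
  rw [h3]
  have hc := h.pos
  refine mul_nonpos_of_nonneg_of_nonpos hc.le ?_
  have h4 : c * (inner ℂ y (R f)).re ≤ 0 := mul_nonpos_of_nonneg_of_nonpos hc.le h2
  nlinarith [sq_nonneg ‖y‖]

lemma yosida_apply_eq (h : IsContractiveResolvent A c R) (x : A.domain) :
    yosida c R x = (c : ℂ) • R (A x) := by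
  rw [yosida_apply, h.apply_map]

/-- The difference is `R (A x)`, so `cR` tends to the identity on the domain at rate `1 / c`. -/
lemma norm_smul_apply_sub_le (h : IsContractiveResolvent A c R) (x : A.domain) :
    ‖(c : ℂ) • R x - x‖ ≤ c⁻¹ * ‖A x‖ := by
  rw [← h.apply_map, inv_mul_eq_div, le_div_iff₀ h.pos, mul_comm]
  exact h.norm_le _

end IsContractiveResolvent

end Resolvent

/-! ### Estimates for exponentials of bounded dissipative operators. -/

variable [CompleteSpace X]

lemma hasDerivAt_exp_smul_apply (B : X →L[ℂ] X) (x : X) (t : ℝ) :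
    HasDerivAt (fun s : ℝ => NormedSpace.exp (s • B) x) (NormedSpace.exp (t • B) (B x)) t := by
  have h := hasDerivAt_exp_smul_const (𝕂 := ℝ) B t
  exact ((ContinuousLinearMap.apply ℂ X x).restrictScalars ℝ).hasFDerivAt.comp_hasDerivAt t h

lemma exp_smul_apply_comm {B C : X →L[ℂ] X} (h : Commute B C) (t : ℝ) (x : X) :
    NormedSpace.exp (t • B) (C x) = C (NormedSpace.exp (t • B) x) := by
  have := (h.smul_left t).exp_left
  exact DFunLike.congr_fun this x

/-- Along an orbit `v' = Bv` the derivative of `‖v‖²` is `2 Re⟨v, Bv⟩ ≤ 0`. -/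
lemma norm_exp_smul_apply_le {B : X →L[ℂ] X} (hB : ∀ x, (inner ℂ (B x) x).re ≤ 0) {t : ℝ}
    (ht : 0 ≤ t) (x : X) : ‖NormedSpace.exp (t • B) x‖ ≤ ‖x‖ := by
  let v : ℝ → X := fun s => NormedSpace.exp (s • B) x
  have hv : ∀ s, HasDerivAt v (B (v s)) s := fun s => by
    have := hasDerivAt_exp_smul_apply B x s
    rwa [exp_smul_apply_comm (Commute.refl B)] at this
  let _ := InnerProductSpace.rclikeToReal ℂ X
  have hd : ∀ s, HasDerivAt (fun s => ‖v s‖ ^ 2) (2 * inner ℝ (v s) (B (v s))) s := fun s =>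
    (hv s).norm_sq
  have hanti : Antitone fun s => ‖v s‖ ^ 2 := by
    refine antitone_of_deriv_nonpos (fun s => (hd s).differentiableAt) fun s => ?_
    rw [(hd s).deriv]
    have h1 : inner ℝ (v s) (B (v s)) = (inner ℂ (v s) (B (v s))).re := rfl
    have h2 := hB (v s)
    rw [← inner_conj_symm, Complex.conj_re] at h2
    rw [h1]
    linarith
  have h := hanti ht
  simp only [v, zero_smul, NormedSpace.exp_zero] at h
  exact le_of_sq_le_sq h (norm_nonneg _)

/-- Interpolate by `s ↦ exp(sB) exp((t-s)C) x`. Because `B` and `C` commute, the derivative is two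
contractions applied to `Bx - Cx`, and the mean value inequality on `[0, t]` finishes. -/
lemma norm_exp_smul_sub_le {B C : X →L[ℂ] X} (hB : ∀ x, (inner ℂ (B x) x).re ≤ 0)
    (hC : ∀ x, (inner ℂ (C x) x).re ≤ 0) (hBC : Commute B C) {t : ℝ} (ht : 0 ≤ t) (x : X) :
    ‖NormedSpace.exp (t • B) x - NormedSpace.exp (t • C) x‖ ≤ t * ‖B x - C x‖ := by
  have hd : ∀ s, HasDerivAt (fun s : ℝ => NormedSpace.exp (s • B) (NormedSpace.exp ((t - s) • C) x))
      (NormedSpace.exp (s • B) (NormedSpace.exp ((t - s) • C) (B x - C x))) s := fun s => by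
    have h1 := hasDerivAt_exp_smul_const (𝕂 := ℝ) B s
    have h2 := (hasDerivAt_exp_smul_apply C x (t - s)).scomp s ((hasDerivAt_id s).const_sub t)
    have h3 := ((ContinuousLinearMap.restrictScalarsL ℂ X X ℝ ℝ).hasFDerivAt.comp_hasDerivAt s
      h1).clm_apply h2
    refine h3.congr_deriv ?_
    simp only [map_sub]
    rw [exp_smul_apply_comm hBC.symm]
    simp [sub_eq_add_neg]
  have h := norm_image_sub_le_of_norm_deriv_le_segment' (a := 0) (b := t) (C := ‖B x - C x‖)
    (fun s _ => (hd s).hasDerivWithinAt) (fun s hs => by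
      refine (norm_exp_smul_apply_le hB hs.1 _).trans
        (norm_exp_smul_apply_le hC (sub_nonneg.2 hs.2.le) _)) t ⟨ht, le_rfl⟩
  simpa [mul_comm] using h

lemma norm_exp_smul_sub_self_le {B : X →L[ℂ] X} (hB : ∀ x, (inner ℂ (B x) x).re ≤ 0)
    {t : ℝ} (ht : 0 ≤ t) (x : X) : ‖NormedSpace.exp (t • B) x - x‖ ≤ t * ‖B x‖ := by
  simpa using norm_exp_smul_sub_le (C := 0) hB (by simp) (Commute.zero_right B) ht x

/-- A second order Taylor bound would involve `‖B (B x)‖`, which need not stay bounded along the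
Yosida approximations. Comparing `Bx` with an auxiliary `y` leaves only `‖By‖`, which converges once
`y` is taken in the domain of `A`. -/
lemma norm_exp_smul_sub_self_sub_le {B : X →L[ℂ] X} (hB : ∀ x, (inner ℂ (B x) x).re ≤ 0)
    {t : ℝ} (ht : 0 ≤ t) (x y : X) :
    ‖NormedSpace.exp (t • B) x - x - t • B x‖ ≤ t * (2 * ‖B x - y‖ + t * ‖B y‖) := by
  have hd : ∀ s, HasDerivAt (fun s : ℝ => NormedSpace.exp (s • B) x - s • B x)
      (NormedSpace.exp (s • B) (B x) - B x) s := fun s =>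
    ((hasDerivAt_exp_smul_apply B x s).sub ((hasDerivAt_id s).smul_const (B x))).congr_deriv
      (by simp)
  have h := norm_image_sub_le_of_norm_deriv_le_segment' (a := 0) (b := t)
    (C := 2 * ‖B x - y‖ + t * ‖B y‖)
    (fun s _ => (hd s).hasDerivWithinAt) (fun s hs => by
      have e : NormedSpace.exp (s • B) (B x) - B x = NormedSpace.exp (s • B) (B x - y) +
          (NormedSpace.exp (s • B) y - y) - (B x - y) := by rw [map_sub]; abel
      have h1 := norm_exp_smul_apply_le hB hs.1 (B x - y)
      have h2 := norm_exp_smul_sub_self_le hB hs.1 y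
      have h3 : s * ‖B y‖ ≤ t * ‖B y‖ := by gcongr; exact hs.2.le
      rw [e]
      refine (norm_sub_le _ _).trans ?_
      have h4 := norm_add_le (NormedSpace.exp (s • B) (B x - y)) (NormedSpace.exp (s • B) y - y)
      linarith) t ⟨ht, le_rfl⟩
  rw [show NormedSpace.exp (t • B) x - x - t • B x = NormedSpace.exp (t • B) x - t • B x -
    (NormedSpace.exp ((0:ℝ) • B) x - (0:ℝ) • B x) by simp; abel]
  linarith [h, mul_comm t (2 * ‖B x - y‖ + t * ‖B y‖), sub_zero t]


/-! ### Density of the domain and passage to the limit semigroup. -/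

/-- Write a vector orthogonal to the domain as `w - Aw`. Pairing it with `w` gives `‖w‖² = Re⟨Aw, w⟩
≤ 0`, so `w` and the vector vanish. -/
lemma LinearPMap.dense_domain_of_dissipative {A : X →ₗ.[ℂ] X}
    (hA : ∀ x : A.domain, (inner ℂ (A x) (x : X)).re ≤ 0)
    (hs : ∀ f, ∃ x : A.domain, (x : X) - A x = f) : Dense (A.domain : Set X) := by
  rw [Submodule.dense_iff_topologicalClosure_eq_top, Submodule.topologicalClosure_eq_top_iff,
    Submodule.eq_bot_iff]
  intro v hv
  obtain ⟨w, hw⟩ := hs v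
  have h1 : inner ℂ v (w : X) = 0 := (Submodule.mem_orthogonal' _ _).1 hv w w.2
  have h2 := hA w
  rw [← hw, inner_sub_left, inner_self_eq_norm_sq_to_K, sub_eq_zero] at h1
  rw [← h1] at h2
  have h3 : ‖(w : X)‖ ^ 2 ≤ 0 := by exact_mod_cast h2
  have h4 : (w : X) = 0 := by
    rw [← norm_le_zero_iff]
    nlinarith [norm_nonneg (w : X)]
  rw [← hw, h4, Submodule.coe_eq_zero.1 h4, LinearPMap.map_zero, sub_zero]

/-- The exponentials of commuting dissipative operators `B n` that converge pointwise on a dense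
set converge pointwise. -/
lemma exists_tendsto_exp_smul_apply {B : ℕ → X →L[ℂ] X} (hB : ∀ n x, (inner ℂ (B n x) x).re ≤ 0)
    (hcomm : ∀ k n, Commute (B k) (B n)) {D : Set X} (hD : Dense D)
    (hconv : ∀ x ∈ D, ∃ y, Tendsto (fun n => B n x) atTop (𝓝 y)) {t : ℝ} (ht : 0 ≤ t) (x : X) :
    ∃ z, Tendsto (fun n => NormedSpace.exp (t • B n) x) atTop (𝓝 z) := by
  refine cauchySeq_tendsto_of_complete (Metric.cauchySeq_iff.2 fun ε hε => ?_)
  obtain ⟨x', hx', hxx⟩ := hD.exists_dist_lt x (show 0 < ε / 4 by positivity)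
  obtain ⟨y, hy⟩ := hconv x' hx'
  -- The denominator `t + 1` rather than `t` covers `t = 0`. Replacing `x` by `x'` costs less than
  -- `ε / 4` for each exponential, and the comparison at `x'` costs at most `ε / 4`.
  obtain ⟨N, hN⟩ := Metric.cauchySeq_iff.1 hy.cauchySeq (ε / 4 / (t + 1)) (by positivity)
  refine ⟨N, fun k hk n hn => ?_⟩
  have h1 := norm_exp_smul_apply_le (hB k) ht (x - x')
  have h2 := norm_exp_smul_apply_le (hB n) ht (x - x')
  have h3 := norm_exp_smul_sub_le (hB k) (hB n) (hcomm k n) ht x'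
  have h4 := hN k hk n hn
  rw [dist_eq_norm] at h4 hxx ⊢
  have h5 : t * ‖B k x' - B n x'‖ ≤ ε / 4 := by
    calc t * ‖B k x' - B n x'‖ ≤ (t + 1) * (ε / 4 / (t + 1)) := by gcongr; linarith
      _ = ε / 4 := by field_simp
  have e : NormedSpace.exp (t • B k) x - NormedSpace.exp (t • B n) x =
      NormedSpace.exp (t • B k) (x - x') + (NormedSpace.exp (t • B k) x' -
        NormedSpace.exp (t • B n) x') - NormedSpace.exp (t • B n) (x - x') := by
    simp only [map_sub]; abel
  rw [e]
  have h6 := norm_sub_le (NormedSpace.exp (t • B k) (x - x') + (NormedSpace.exp (t • B k) x' -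
        NormedSpace.exp (t • B n) x')) (NormedSpace.exp (t • B n) (x - x'))
  have h7 := norm_add_le (NormedSpace.exp (t • B k) (x - x')) (NormedSpace.exp (t • B k) x' -
        NormedSpace.exp (t • B n) x')
  linarith

/-- A pointwise limit of the contraction semigroups generated by dissipative operators `B n` is a
contraction semigroup, and its generator extends the pointwise limit of the `B n`. -/
lemma exists_semigroup_of_tendsto {B : ℕ → X →L[ℂ] X} (hB : ∀ n x, (inner ℂ (B n x) x).re ≤ 0)
    (hcomm : ∀ k n, Commute (B k) (B n)) {A : X →ₗ.[ℂ] X} (hD : Dense (A.domain : Set X))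
    (hconv : ∀ x : A.domain, Tendsto (fun n => B n x) atTop (𝓝 (A x))) :
    ∃ T : ℝ≥0 → X →L[ℂ] X, IsC0Semigroup T ∧ (∀ t x, ‖T t x‖ ≤ ‖x‖) ∧
      ∀ x : A.domain, HasOrbitDeriv T x (A x) := by
  have hex : ∀ (t : ℝ≥0) (x : X),
      ∃ z, Tendsto (fun n => NormedSpace.exp ((t : ℝ) • B n) x) atTop (𝓝 z) := fun t x =>
    exists_tendsto_exp_smul_apply hB hcomm hD (fun x hx => ⟨_, hconv ⟨x, hx⟩⟩) t.2 x
  choose S hS using hex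
  let T : ℝ≥0 → X →L[ℂ] X := fun t => continuousLinearMapOfTendsto
    (fun n => NormedSpace.exp ((t : ℝ) • B n)) (tendsto_pi_nhds.2 (hS t))
  have hT : ∀ (t : ℝ≥0) x, Tendsto (fun n => NormedSpace.exp ((t : ℝ) • B n) x) atTop (𝓝 (T t x)) := hS
  have hcontr : ∀ t x, ‖T t x‖ ≤ ‖x‖ := fun t x =>
    le_of_tendsto (hT t x).norm (.of_forall fun n => norm_exp_smul_apply_le (hB n) t.2 x)
  have hadd : ∀ s t x, T (s + t) x = T s (T t x) := fun s t x => by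
    refine tendsto_nhds_unique (hT (s + t) x) ?_
    -- Strong limits of products need uniform boundedness; here contractivity lets the inner error
    -- pass through the outer exponential.
    have h1 : Tendsto (fun n => NormedSpace.exp ((s : ℝ) • B n)
        (NormedSpace.exp ((t : ℝ) • B n) x - T t x)) atTop (𝓝 0) := by
      refine squeeze_zero_norm (fun n => norm_exp_smul_apply_le (hB n) s.2 _) ?_
      simpa using ((hT t x).sub_const (T t x)).norm
    have h2 := h1.add (hT s (T t x))
    rw [zero_add] at h2
    let _ : NormedAlgebra ℚ (X →L[ℂ] X) := NormedAlgebra.restrictScalars ℚ ℂ _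
    refine h2.congr fun n => ?_
    rw [map_sub, sub_add_cancel, NNReal.coe_add, add_smul, NormedSpace.exp_add_of_commute
      (((Commute.refl (B n)).smul_left _).smul_right _)]
    rfl
  have hsub : ∀ (t : ℝ≥0) (x : A.domain), ‖T t x - x‖ ≤ t * ‖A x‖ := fun t x =>
    le_of_tendsto_of_tendsto ((hT t x).sub_const _).norm ((hconv x).norm.const_mul _)
      (.of_forall fun n => norm_exp_smul_sub_self_le (hB n) t.2 x)
  have hzero : ∀ x, T 0 x = x := fun x => tendsto_nhds_unique (hT 0 x) (by simp)
  refine ⟨T, ⟨ContinuousLinearMap.ext hzero, fun s t => ContinuousLinearMap.ext (hadd s t),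
    fun x => ?_⟩, hcontr, fun x => ?_⟩
  · have hle : ∀ (y : A.domain) (s t : ℝ≥0), s ≤ t → dist (T s y) (T t y) ≤ ‖A y‖ * dist s t :=
      fun y s t hst => by
      obtain ⟨r, rfl⟩ := exists_add_of_le hst
      rw [dist_comm, dist_eq_norm, hadd, ← map_sub, NNReal.dist_eq]
      refine (hcontr s _).trans ((hsub r y).trans_eq ?_)
      simp [mul_comm]
    have hlip : ∀ (y : A.domain) (s t : ℝ≥0), dist (T s y) (T t y) ≤ ‖A y‖ * dist s t :=
      fun y s t => by
      rcases le_total s t with h | h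
      · exact hle y s t h
      · rw [dist_comm, dist_comm s]
        exact hle y t s h
    refine Metric.continuous_iff.2 fun s ε hε => ?_
    obtain ⟨y, hy, hxy⟩ := hD.exists_dist_lt x (show 0 < ε / 4 by positivity)
    lift y to A.domain using hy
    refine ⟨ε / 4 / (‖A y‖ + 1), by positivity, fun t ht => ?_⟩
    have h1 : dist (T t x) (T t y) ≤ dist x y := by
      rw [dist_eq_norm, dist_eq_norm, ← map_sub]; exact hcontr _ _
    have h2 : dist (T s y) (T s x) ≤ dist x y := by
      rw [dist_comm, dist_eq_norm, dist_eq_norm, ← map_sub]; exact hcontr _ _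
    have h3 : ‖A y‖ * dist t s ≤ ε / 4 := by
      calc ‖A y‖ * dist t s ≤ (‖A y‖ + 1) * (ε / 4 / (‖A y‖ + 1)) := by gcongr; linarith
        _ = ε / 4 := by field_simp
    have h4 := hlip y t s
    have h5 := dist_triangle4 (T t x) (T t y) (T s y) (T s x)
    linarith
  -- The limit of the Taylor estimate. Choosing `y` in the domain close to `A x` makes the first
  -- error term small, and then small `t` handles the second.
  · have key : ∀ (t : ℝ≥0) (y : A.domain), ‖T t x - x - (t : ℝ) • A x‖ ≤
        t * (2 * ‖A x - y‖ + t * ‖A y‖) := fun t y =>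
      le_of_tendsto_of_tendsto
        (((hT t x).sub_const (x : X)).sub ((hconv x).const_smul (t : ℝ))).norm
        (((((hconv x).sub_const (y : X)).norm.const_mul 2).add
          ((hconv y).norm.const_mul (t : ℝ))).const_mul (t : ℝ))
        (.of_forall fun n => norm_exp_smul_sub_self_sub_le (hB n) t.2 x y)
    refine Metric.tendsto_nhds.2 fun ε hε => ?_
    obtain ⟨y, hy, hxy⟩ := hD.exists_dist_lt (A x) (show 0 < ε / 4 by positivity)
    lift y to A.domain using hy
    have hδ : 0 < (ε / 4 / (‖A y‖ + 1)).toNNReal := Real.toNNReal_pos.2 (by positivity)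
    filter_upwards [Ioo_mem_nhdsGT hδ] with t ht
    have ht0 : (0 : ℝ) < t := ht.1
    have ht1 : (t : ℝ) < ε / 4 / (‖A y‖ + 1) := Real.lt_toNNReal_iff_coe_lt.1 ht.2
    have h1 : (t : ℝ)⁻¹ • (T t x - x) - A x = (t : ℝ)⁻¹ • (T t x - x - (t : ℝ) • A x) := by
      rw [smul_sub _ _ ((t : ℝ) • A x), inv_smul_smul₀ ht0.ne']
    have h2 : (t : ℝ) * ‖A y‖ ≤ ε / 4 := by
      calc (t : ℝ) * ‖A y‖ ≤ (ε / 4 / (‖A y‖ + 1)) * (‖A y‖ + 1) := by gcongr; linarith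
        _ = ε / 4 := by field_simp
    rw [dist_eq_norm, h1, norm_smul, norm_inv, Real.norm_of_nonneg ht0.le, inv_mul_lt_iff₀ ht0]
    refine (key t y).trans_lt ?_
    rw [dist_eq_norm] at hxy
    gcongr
    linarith

/-- A maximal dissipative operator on a Hilbert space generates a contraction semigroup. -/
theorem LinearPMap.exists_contractionSemigroup {A : X →ₗ.[ℂ] X}
    (hA : ∀ x : A.domain, (inner ℂ (A x) (x : X)).re ≤ 0)
    (hs : ∀ c : ℝ, 0 < c → ∀ f, ∃ x : A.domain, (c : ℂ) • (x : X) - A x = f) :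
    ∃ T : ℝ≥0 → X →L[ℂ] X, IsC0Semigroup T ∧ (∀ t, ‖T t‖ ≤ 1) ∧ semigroupGenerator T = A := by
  have hs1 : ∀ f, ∃ x : A.domain, (x : X) - A x = f := fun f => by
    simpa using hs 1 one_pos f
  have hD := dense_domain_of_dissipative hA hs1
  have hpos : ∀ n : ℕ, (0 : ℝ) < n + 1 := fun n => by positivity
  choose R hR using fun n : ℕ => exists_isContractiveResolvent hA (hpos n) (hs _ (hpos n))
  -- The contractions `(n+1) R n` tend strongly to the identity: directly on the domain, elsewhere
  -- by density. Applied to `A x`, this is convergence of the Yosida approximations.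
  have hJ : ∀ x, Tendsto (fun n : ℕ => (((n : ℝ) + 1 : ℝ) : ℂ) • R n x) atTop (𝓝 x) := fun x => by
    refine Metric.tendsto_atTop.2 fun ε hε => ?_
    obtain ⟨y, hy, hxy⟩ := hD.exists_dist_lt x (show 0 < ε / 4 by positivity)
    lift y to A.domain using hy
    have h0 : Tendsto (fun n : ℕ => ((n : ℝ) + 1)⁻¹ * ‖A y‖) atTop (𝓝 0) := by
      have := (tendsto_one_div_add_atTop_nhds_zero_nat (𝕜 := ℝ)).mul_const ‖A y‖
      simpa using this
    obtain ⟨N, hN⟩ := Filter.eventually_atTop.1 (h0.eventually_lt_const (show 0 < ε / 4 by positivity))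
    refine ⟨N, fun n hn => ?_⟩
    have h1 := (hR n).norm_smul_apply_sub_le y
    have h2 := hN n hn
    have h3 : ‖(((n : ℝ) + 1 : ℝ) : ℂ) • R n (x - y)‖ ≤ ‖x - y‖ := by
      rw [norm_smul, Complex.norm_real, Real.norm_of_nonneg (hpos n).le]
      exact (hR n).norm_le _
    have e : (((n : ℝ) + 1 : ℝ) : ℂ) • R n x - x = (((n : ℝ) + 1 : ℝ) : ℂ) • R n (x - y) +
        ((((n : ℝ) + 1 : ℝ) : ℂ) • R n y - y) - (x - y) := by
      rw [_root_.map_sub, smul_sub]; abel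
    rw [dist_eq_norm] at hxy ⊢
    rw [e]
    have h4 := norm_sub_le ((((n : ℝ) + 1 : ℝ) : ℂ) • R n (x - y) +
        ((((n : ℝ) + 1 : ℝ) : ℂ) • R n y - y)) (x - y)
    have h5 := norm_add_le ((((n : ℝ) + 1 : ℝ) : ℂ) • R n (x - y))
        ((((n : ℝ) + 1 : ℝ) : ℂ) • R n y - y)
    linarith
  obtain ⟨T, hT, hcontr, hderiv⟩ := exists_semigroup_of_tendsto
    (B := fun n => IsContractiveResolvent.yosida ((n : ℝ) + 1) (R n))
    (fun n x => (hR n).yosida_dissipative hA x) (fun k n => (hR k).commute_yosida (hR n)) hD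
    (fun x => by
      simp only [(hR _).yosida_apply_eq x]
      exact hJ (A x))
  refine ⟨T, hT, fun t => (T t).opNorm_le_bound zero_le_one fun x => by simpa using hcontr t x, ?_⟩
  -- The generator is dissipative because `Re⟨T t x, x⟩ ≤ ‖x‖²`; divide by `t` and let `t` tend to
  -- `0`.
  have hgen : ∀ {x y}, HasOrbitDeriv T x y → (inner ℂ y x).re ≤ 0 := fun {x y} h => by
    have h1 : Tendsto (fun t : ℝ≥0 => (inner ℂ ((t : ℝ)⁻¹ • (T t x - x)) x).re) (𝓝[>] 0)
        (𝓝 (inner ℂ y x).re) :=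
      (Complex.continuous_re.tendsto _).comp (h.inner tendsto_const_nhds)
    refine le_of_tendsto h1 (.of_forall fun t => ?_)
    have h2 : (inner ℂ ((t : ℝ)⁻¹ • (T t x - x)) x).re =
        (t : ℝ)⁻¹ * ((inner ℂ (T t x) x).re - ‖x‖ ^ 2) := by
      rw [← Complex.coe_smul, inner_smul_left, Complex.conj_ofReal, Complex.re_ofReal_mul,
        inner_sub_left, inner_self_eq_norm_sq_to_K, Complex.sub_re]
      norm_cast
    rw [h2]
    refine mul_nonpos_of_nonneg_of_nonpos (by positivity) ?_
    have h3 := (Complex.re_le_norm _).trans (norm_inner_le_norm (𝕜 := ℂ) (T t x) x)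
    nlinarith [hcontr t x, norm_nonneg x]
  -- Maximality: solve `z - Az = x - y` in the domain. Then `x - z` is mapped to itself by the
  -- dissipative generator, so it is zero.
  have hmem : ∀ {x y}, HasOrbitDeriv T x y → ∃ hx : x ∈ A.domain, A ⟨x, hx⟩ = y := fun {x y} h => by
    obtain ⟨z, hz⟩ := hs1 (x - y)
    have h1 : HasOrbitDeriv T (x + (-1 : ℂ) • (z : X)) (y + (-1 : ℂ) • A z) :=
      h.add ((hderiv z).smul (-1))
    have h2 : y + (-1 : ℂ) • A z = x + (-1 : ℂ) • (z : X) := by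
      rw [neg_one_smul, neg_one_smul, ← sub_eq_add_neg, ← sub_eq_add_neg, sub_eq_sub_iff_add_eq_add]
      rw [sub_eq_sub_iff_add_eq_add] at hz
      rw [add_comm y, hz, add_comm]
    have h3 := hgen h1
    rw [h2, inner_self_eq_norm_sq_to_K] at h3
    have h4 : ‖x + (-1 : ℂ) • (z : X)‖ ^ 2 ≤ 0 := by exact_mod_cast h3
    have h5 : x + (-1 : ℂ) • (z : X) = 0 := by
      rw [← norm_le_zero_iff]
      nlinarith [norm_nonneg (x + (-1 : ℂ) • (z : X))]
    rw [neg_one_smul, ← sub_eq_add_neg, sub_eq_zero] at h5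
    subst h5
    exact ⟨z.2, (hderiv z).unique h⟩
  refine LinearPMap.ext (Submodule.ext fun x => ⟨fun ⟨y, hy⟩ => (hmem hy).1,
    fun hx => ⟨_, hderiv ⟨x, hx⟩⟩⟩) fun x hx hx' => ?_
  exact hx.choose_spec.unique (hderiv ⟨x, hx'⟩)

end Generation

/-! ### Weak divergences and the density of test functions in `H¹` -/

section WeakDivergence

open scoped SchwartzMap ContDiff Laplacian FourierTransform

/-- `ℂ^m`-valued Schwartz functions on `ℝ^d`. -/
abbrev SchwartzVec (d m : ℕ) : Type := 𝓢(EuclideanSpace ℝ (Fin d), EuclideanSpace ℂ (Fin m))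

/-- `ℂ^m`-valued tempered distributions on `ℝ^d`. -/
abbrev TemperedVec (d m : ℕ) : Type := 𝓢'(EuclideanSpace ℝ (Fin d), EuclideanSpace ℂ (Fin m))

variable {d m : ℕ}

/-- The standard basis vectors of `ℝ^d`. -/
noncomputable abbrev stdVec (i : Fin d) : EuclideanSpace ℝ (Fin d) := EuclideanSpace.single i 1

/-- `g = ∑ i, ∂_i h_i` in the sense of distributions. -/
def IsWeakDiv (h : Fin d → LTwo d m) (g : LTwo d m) : Prop :=
  ∀ φ : EuclideanSpace ℝ (Fin d) → ℝ, ContDiff ℝ ∞ φ → HasCompactSupport φ →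
    (∫ x, φ x • g x) + ∑ i, ∫ x, fderiv ℝ φ x (stdVec i) • h i x = 0

/-- Smooth cutoff functions exhausting `ℝ^d`, with uniformly bounded gradient. -/
lemma exists_cutoff (d : ℕ) : ∃ (ζ : ℕ → EuclideanSpace ℝ (Fin d) → ℝ) (C : ℝ),
    (∀ n, ContDiff ℝ ∞ (ζ n)) ∧ (∀ n, HasCompactSupport (ζ n)) ∧
    (∀ n x, 0 ≤ ζ n x) ∧ (∀ n x, ζ n x ≤ 1) ∧ (∀ n x, ‖fderiv ℝ (ζ n) x‖ ≤ C) ∧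
    ∀ x, ∀ᶠ n in atTop, ζ n =ᶠ[𝓝 x] 1 := by
  let χ : ContDiffBump (0 : EuclideanSpace ℝ (Fin d)) := ⟨1, 2, one_pos, one_lt_two⟩
  have hc : ∀ n : ℕ, (0 : ℝ) < ((n : ℝ) + 1)⁻¹ := fun n => by positivity
  have hsm : ContDiff ℝ ∞ χ := χ.contDiff
  obtain ⟨C, hC⟩ := (χ.hasCompactSupport.fderiv (𝕜 := ℝ)).exists_bound_of_continuous
    (hsm.continuous_fderiv (by simp))
  have hC0 : 0 ≤ C := (norm_nonneg _).trans (hC 0)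
  refine ⟨fun n x => χ (((n : ℝ) + 1)⁻¹ • x), C, fun n => hsm.comp (contDiff_const_smul _),
    fun n => χ.hasCompactSupport.comp_smul (hc n).ne', fun n x => χ.nonneg, fun n x => χ.le_one,
    fun n x => ?_, fun x => ?_⟩
  · have h1 : fderiv ℝ (fun x => χ (((n : ℝ) + 1)⁻¹ • x)) x =
        ((n : ℝ) + 1)⁻¹ • fderiv ℝ χ (((n : ℝ) + 1)⁻¹ • x) := by
      exact fderiv_comp_smul ..
    rw [h1, norm_smul, Real.norm_of_nonneg (hc n).le]
    calc _ ≤ 1 * C := by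
          gcongr
          · exact inv_le_one_of_one_le₀ (by linarith [n.cast_nonneg (α := ℝ)])
          · exact hC _
      _ = C := one_mul C
  -- Equality on a neighbourhood, not just at `x`, is needed so that the gradients also vanish
  -- eventually at `x`.
  · obtain ⟨N, hN⟩ := exists_nat_gt ‖x‖
    filter_upwards [eventually_ge_atTop N] with n hn
    have h1 : ‖x‖ < (n : ℝ) + 1 := by
      have : (N : ℝ) ≤ n := by exact_mod_cast hn
      linarith
    filter_upwards [(continuous_norm.continuousAt (x := x)).eventually_lt_const h1] with y hy
    refine χ.one_of_mem_closedBall ?_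
    rw [mem_closedBall_zero_iff, norm_smul, Real.norm_of_nonneg (hc n).le]
    change _ ≤ (1 : ℝ)
    rw [inv_mul_le_iff₀ (by positivity)]
    linarith

lemma LTwo.integrable_smul_of_memLp {u : LTwo d m} {f : EuclideanSpace ℝ (Fin d) → ℂ}
    (hf : MemLp f 2 volume) : Integrable (fun x => f x • u x) := by
  rw [← memLp_one_iff_integrable]
  exact (Lp.memLp u).smul hf

lemma LTwo.integrable_smul_of_hasCompactSupport {u : LTwo d m}
    {f : EuclideanSpace ℝ (Fin d) → ℝ} (hf : Continuous f) (hf' : HasCompactSupport f) :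
    Integrable (fun x => f x • u x) :=
  u.locallyIntegrable.integrable_smul_left_of_hasCompactSupport hf hf'

/-- The defining relation of a weak divergence for complex test functions. -/
lemma IsWeakDiv.complex {h : Fin d → LTwo d m} {g : LTwo d m} (hg : IsWeakDiv h g)
    {φ : EuclideanSpace ℝ (Fin d) → ℂ} (hφ : ContDiff ℝ ∞ φ) (hφ' : HasCompactSupport φ) :
    (∫ x, φ x • g x) + ∑ i, ∫ x, fderiv ℝ φ x (stdVec i) • h i x = 0 := by
  have hre : ContDiff ℝ ∞ fun x => (φ x).re := Complex.reCLM.contDiff.comp hφ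
  have him : ContDiff ℝ ∞ fun x => (φ x).im := Complex.imCLM.contDiff.comp hφ
  have hre' : HasCompactSupport fun x => (φ x).re := hφ'.comp_left (g := Complex.re) rfl
  have him' : HasCompactSupport fun x => (φ x).im := hφ'.comp_left (g := Complex.im) rfl
  have hsplit : ∀ (f₁ f₂ : EuclideanSpace ℝ (Fin d) → ℝ) (f : EuclideanSpace ℝ (Fin d) → ℂ)
      (u : LTwo d m), (∀ x, f x = f₁ x + f₂ x * Complex.I) → Continuous f₁ → Continuous f₂ →
      HasCompactSupport f₁ → HasCompactSupport f₂ →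
      ∫ x, f x • u x = (∫ x, f₁ x • u x) + Complex.I • ∫ x, f₂ x • u x := by
    intro f₁ f₂ f u hf h1 h2 h1' h2'
    rw [← integral_smul, ← integral_add (u.integrable_smul_of_hasCompactSupport h1 h1')
      (f := fun x => f₁ x • u x) (g := fun x => Complex.I • f₂ x • u x)
      ((u.integrable_smul_of_hasCompactSupport h2 h2').smul Complex.I)]
    congr 1 with x : 1
    rw [hf, add_smul, mul_comm, mul_smul, Complex.coe_smul, Complex.coe_smul]
  have hderiv : ∀ i x, fderiv ℝ φ x (stdVec i) = (fderiv ℝ (fun x => (φ x).re) x (stdVec i) : ℂ) +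
      (fderiv ℝ (fun x => (φ x).im) x (stdVec i) : ℂ) * Complex.I := fun i x => by
    have hd : DifferentiableAt ℝ φ x := (hφ.differentiable (by simp)).differentiableAt
    have h1 : fderiv ℝ (fun x => (φ x).re) x = Complex.reCLM.comp (fderiv ℝ φ x) :=
      (Complex.reCLM.hasFDerivAt.comp x hd.hasFDerivAt).fderiv
    have h2 : fderiv ℝ (fun x => (φ x).im) x = Complex.imCLM.comp (fderiv ℝ φ x) :=
      (Complex.imCLM.hasFDerivAt.comp x hd.hasFDerivAt).fderiv
    rw [h1, h2]
    exact (Complex.re_add_im _).symm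
  have hcd : ∀ {f : EuclideanSpace ℝ (Fin d) → ℝ}, ContDiff ℝ ∞ f → ∀ i : Fin d,
      Continuous fun x => fderiv ℝ f x (stdVec i) := fun hf i =>
    (hf.continuous_fderiv (by simp)).clm_apply continuous_const
  have hcs : ∀ {f : EuclideanSpace ℝ (Fin d) → ℝ}, HasCompactSupport f → ∀ i : Fin d,
      HasCompactSupport fun x => fderiv ℝ f x (stdVec i) := fun hf i => hf.fderiv_apply ℝ _
  rw [hsplit _ _ φ g (fun x => (Complex.re_add_im _).symm) hre.continuous him.continuous hre' him']
  simp only [fun i => hsplit _ _ _ (h i) (hderiv i) (hcd hre i) (hcd him i) (hcs hre' i)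
    (hcs him' i)]
  rw [Finset.sum_add_distrib, ← Finset.smul_sum, add_add_add_comm, ← smul_add,
    hg _ hre hre', hg _ him him', smul_zero, add_zero]

/-- A weak divergence in `L²` is a divergence in the sense of tempered distributions. -/
lemma IsWeakDiv.temperedDistribution {h : Fin d → LTwo d m} {g : LTwo d m} (hg : IsWeakDiv h g) :
    ∑ i, ∂_{stdVec i} (Lp.toTemperedDistribution (h i)) = Lp.toTemperedDistribution g := by
  ext1 ψ
  obtain ⟨ζ, C, hζ, hζc, hζ0, hζ1, hζC, hζlim⟩ := exists_cutoff d
  have hψ : ContDiff ℝ ∞ ψ := ψ.smooth'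
  have hsm : ∀ n, ContDiff ℝ ∞ (fun x => ζ n x • ψ x) := fun n => (hζ n).smul hψ
  have hcs : ∀ n, HasCompactSupport (fun x => ζ n x • ψ x) := fun n => (hζc n).smul_right
  have hzero := fun n => hg.complex (hsm n) (hcs n)
  have hψLp : MemLp ψ 2 volume := ψ.memLp 2
  have hψLp' : ∀ i : Fin d, MemLp (⇑(∂_{stdVec i} ψ : 𝓢(EuclideanSpace ℝ (Fin d), ℂ))) 2 volume := fun i => (∂_{stdVec i} ψ).memLp 2
  have lim0 : Tendsto (fun n => ∫ x, (ζ n x • ψ x) • g x) atTop (𝓝 (∫ x, ψ x • g x)) := by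
    refine tendsto_integral_of_dominated_convergence (fun x => ‖ψ x • g x‖) (fun n => ?_)
      (LTwo.integrable_smul_of_memLp hψLp).norm (fun n => .of_forall fun x => ?_)
      (.of_forall fun x => ?_)
    · exact (hsm n).continuous.aestronglyMeasurable.smul (Lp.aestronglyMeasurable g)
    · rw [smul_assoc, norm_smul, Real.norm_of_nonneg (hζ0 n x)]
      exact mul_le_of_le_one_left (norm_nonneg _) (hζ1 n x)
    · refine tendsto_const_nhds.congr' ?_
      filter_upwards [hζlim x] with n hn
      rw [hn.self_of_nhds, Pi.one_apply, one_smul]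
  have lim1 : ∀ i, Tendsto (fun n => ∫ x, fderiv ℝ (fun x => ζ n x • ψ x) x (stdVec i) • h i x)
      atTop (𝓝 (∫ x, (∂_{stdVec i} ψ : 𝓢(EuclideanSpace ℝ (Fin d), ℂ)) x • h i x)) := fun i => by
    -- The product rule yields a term in `∂ζ`; the uniform gradient bound `C` supplies its
    -- dominating function.
    refine tendsto_integral_of_dominated_convergence
      (fun x => ‖(∂_{stdVec i} ψ : 𝓢(EuclideanSpace ℝ (Fin d), ℂ)) x • h i x‖ + C * ‖ψ x • h i x‖) (fun n => ?_)
      ((LTwo.integrable_smul_of_memLp (hψLp' i)).norm.add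
        ((LTwo.integrable_smul_of_memLp hψLp).norm.const_mul C))
      (fun n => .of_forall fun x => ?_)
      (.of_forall fun x => ?_)
    · exact (((hsm n).continuous_fderiv (by simp)).clm_apply
        continuous_const).aestronglyMeasurable.smul (Lp.aestronglyMeasurable (h i))
    · have h1 : fderiv ℝ (fun x => ζ n x • ψ x) x (stdVec i) =
          ζ n x • (∂_{stdVec i} ψ : 𝓢(EuclideanSpace ℝ (Fin d), ℂ)) x + fderiv ℝ (ζ n) x (stdVec i) • ψ x := by
        rw [fderiv_fun_smul ((hζ n).differentiable (by simp)).differentiableAt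
          (hψ.differentiable (by simp)).differentiableAt]
        rfl
      have h2 : ‖fderiv ℝ (ζ n) x (stdVec i)‖ ≤ C := by
        refine ((fderiv ℝ (ζ n) x).le_opNorm _).trans ?_
        simpa using hζC n x
      rw [h1, add_smul, smul_assoc, smul_assoc]
      refine (norm_add_le _ _).trans (add_le_add ?_ ?_)
      · rw [norm_smul, Real.norm_of_nonneg (hζ0 n x)]
        exact mul_le_of_le_one_left (norm_nonneg _) (hζ1 n x)
      · rw [norm_smul]
        gcongr
    · refine tendsto_const_nhds.congr' ?_
      filter_upwards [hζlim x] with n hn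
      have : (fun x => ζ n x • ψ x) =ᶠ[𝓝 x] ψ := by
        filter_upwards [hn] with y hy
        rw [hy, Pi.one_apply, one_smul]
      rw [this.fderiv_eq]
      rfl
  have hlim := lim0.add (tendsto_finsetSum Finset.univ fun i _ => lim1 i)
  simp only [hzero] at hlim
  have hval := tendsto_nhds_unique hlim tendsto_const_nhds
  rw [add_eq_zero_iff_eq_neg] at hval
  rw [Lp.toTemperedDistribution_apply, hval, _root_.sum_apply, ← Finset.sum_neg_distrib]
  refine Finset.sum_congr rfl fun i _ => ?_
  rw [TemperedDistribution.lineDerivOp_apply_apply, map_neg, Lp.toTemperedDistribution_apply]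

/-- The passage from test functions to Schwartz functions is the cutoff argument above; conversely,
a real test function is a Schwartz function once viewed with complex values. This makes the Fourier
transform available. -/
lemma isWeakDiv_iff_temperedDistribution {h : Fin d → LTwo d m} {g : LTwo d m} :
    IsWeakDiv h g ↔ ∑ i, ∂_{stdVec i} (Lp.toTemperedDistribution (h i) : TemperedVec d m) =
      Lp.toTemperedDistribution g := by
  refine ⟨fun hg => hg.temperedDistribution, fun hg φ hφ hφ' => ?_⟩
  let ψ : 𝓢(EuclideanSpace ℝ (Fin d), ℂ) := HasCompactSupport.toSchwartzMap
    (f := Complex.ofRealCLM ∘ φ) (hφ'.comp_left rfl) (Complex.ofRealCLM.contDiff.comp hφ)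
  have h1 : ∀ i x, (∂_{stdVec i} ψ : 𝓢(EuclideanSpace ℝ (Fin d), ℂ)) x =
      (fderiv ℝ φ x (stdVec i) : ℂ) := fun i x => by
    change fderiv ℝ (Complex.ofRealCLM ∘ φ) x (stdVec i) = _
    rw [(Complex.ofRealCLM.hasFDerivAt.comp x
      (hφ.differentiable (by simp)).differentiableAt.hasFDerivAt).fderiv]
    rfl
  have h2 := DFunLike.congr_fun hg ψ
  rw [Lp.toTemperedDistribution_apply, _root_.sum_apply] at h2
  simp only [TemperedDistribution.lineDerivOp_apply_apply, map_neg,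
    Lp.toTemperedDistribution_apply, h1, Complex.coe_smul, Finset.sum_neg_distrib] at h2
  have h3 : ∫ x, ψ x • g x = ∫ x, φ x • g x :=
    integral_congr_ae (.of_forall fun x => Complex.coe_smul (φ x) (g x))
  rw [add_comm, add_eq_zero_iff_neg_eq, h2, h3]

/-- A tempered distribution `W` with `ΔW = W` vanishes. -/
lemma TemperedDistribution.eq_zero_of_laplacian_eq_self {F : Type*} [NormedAddCommGroup F]
    [NormedSpace ℂ F] {W : 𝓢'(EuclideanSpace ℝ (Fin d), F)} (hW : Δ W = W) : W = 0 := by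
  rw [laplacian_eq_fourierMultiplierCLM] at hW
  -- The symbol of `(1 - Δ)⁻¹`. The equation gives `g(D) W = -(2π)² (|ξ|² g)(D) W`, while `g + (2π)²
  -- |ξ|² g = 1`, so adding up leaves `W = 0`.
  let g : EuclideanSpace ℝ (Fin d) → ℂ := fun x =>
    Complex.ofReal ((1 + ‖(2 * Real.pi) • x‖ ^ 2) ^ (-1 : ℝ))
  have hg : g.HasTemperateGrowth := by
    have h0 : (fun x : EuclideanSpace ℝ (Fin d) => (1 + ‖x‖ ^ 2) ^ (-1 : ℝ)).HasTemperateGrowth := by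
      fun_prop
    have h1 := h0.comp (g := fun x : EuclideanSpace ℝ (Fin d) => (1 + ‖x‖ ^ 2) ^ (-1 : ℝ))
      (f := fun x => (2 * Real.pi) • x) (by fun_prop)
    have h2 : g = fun x => Complex.ofReal (((fun x : EuclideanSpace ℝ (Fin d) =>
      (1 + ‖x‖ ^ 2) ^ (-1 : ℝ)) ∘ fun x => (2 * Real.pi) • x) x) := rfl
    rw [h2]
    fun_prop
  have hsq : (fun x : EuclideanSpace ℝ (Fin d) => Complex.ofReal (‖x‖ ^ 2)).HasTemperateGrowth := by
    fun_prop
  have hmul := hsq.mul hg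
  have h1 : fourierMultiplierCLM F g W = ((-(2 * Real.pi) ^ 2 : ℝ) : ℂ) •
      fourierMultiplierCLM F ((fun x => Complex.ofReal (‖x‖ ^ 2)) * g) W := by
    conv_lhs => rw [← hW]
    rw [← Complex.coe_smul, map_smul, fourierMultiplierCLM_fourierMultiplierCLM_apply hsq hg]
  have h2 : g + (((2 * Real.pi) ^ 2 : ℝ) : ℂ) • ((fun x => Complex.ofReal (‖x‖ ^ 2)) * g) =
      fun _ => 1 := by
    ext x
    simp only [g, Pi.add_apply, Pi.smul_apply, Pi.mul_apply, smul_eq_mul]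
    rw [Real.rpow_neg_one]
    norm_cast
    rw [norm_smul, Real.norm_of_nonneg (by positivity), mul_pow]
    field_simp
  have h3 : W = fourierMultiplierCLM F (fun _ => 1) W := by simp
  rw [h3, ← h2, fourierMultiplierCLM_apply, smulLeftCLM_add hg (by fun_prop), _root_.add_apply,
    FourierTransform.fourierInv_add, ← fourierMultiplierCLM_apply, ← fourierMultiplierCLM_apply,
    fourierMultiplierCLM_smul hmul, h1, smul_apply, ← add_smul]
  simp

lemma LTwo.toTemperedDistribution_injective {u v : LTwo d m}
    (h : (Lp.toTemperedDistribution u : TemperedVec d m) =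
      Lp.toTemperedDistribution v) : u = v :=
  LinearMap.ker_eq_bot.1 (Lp.ker_toTemperedDistributionCLM_eq_bot
    (F := EuclideanSpace ℂ (Fin m)) (μ := (volume : Measure (EuclideanSpace ℝ (Fin d)))) (p := 2)) h

/-! ### `H¹` as a closed subspace of a Hilbert space of pairs. -/

/-- The Hilbert space of pairs `(u, (g_i)_i)` of a function and a candidate for its gradient. -/
abbrev GradientPair (d m : ℕ) : Type := PiLp 2 fun _ : Option (Fin d) => LTwo d m

/-- The graph of the weak gradient, a Hilbert space isometric to `H¹`. -/
noncomputable def sobolevGraph (d m : ℕ) : Submodule ℂ (GradientPair d m) :=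
  ⨅ i : Fin d, LinearMap.ker
    ((LineDeriv.lineDerivOpCLM ℂ (TemperedVec d m)
        (stdVec i)) ∘L (Lp.toTemperedDistributionCLM (EuclideanSpace ℂ (Fin m)) volume 2) ∘L
      (PiLp.proj 2 (fun _ : Option (Fin d) => LTwo d m) none : GradientPair d m →L[ℂ] LTwo d m) -
      (Lp.toTemperedDistributionCLM (EuclideanSpace ℂ (Fin m)) volume 2) ∘L
      (PiLp.proj 2 (fun _ : Option (Fin d) => LTwo d m) (some i) :
        GradientPair d m →L[ℂ] LTwo d m)).toLinearMap

lemma mem_sobolevGraph {p : GradientPair d m} : p ∈ sobolevGraph d m ↔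
    ∀ i, ∂_{stdVec i} (Lp.toTemperedDistribution (p none) :
      TemperedVec d m) =
      Lp.toTemperedDistribution (p (some i)) := by
  simp only [sobolevGraph, Submodule.mem_iInf, LinearMap.mem_ker]
  refine forall_congr' fun i => ?_
  exact sub_eq_zero

lemma isClosed_sobolevGraph (d m : ℕ) : IsClosed (sobolevGraph d m : Set (GradientPair d m)) := by
  rw [sobolevGraph, Submodule.coe_iInf]
  exact isClosed_iInter fun i => ContinuousLinearMap.isClosed_ker _

instance (d m : ℕ) : CompleteSpace (sobolevGraph d m) :=
  (isClosed_sobolevGraph d m).completeSpace_coe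

/-- The pair `(f, ∇f)` of a Schwartz function `f`. -/
noncomputable def schwartzGraph (d m : ℕ) : SchwartzVec d m →ₗ[ℂ] GradientPair d m where
  toFun f := WithLp.toLp 2 fun o =>
    o.elim (f.toLp 2) fun i => (∂_{stdVec i} f : SchwartzVec d m).toLp 2
  map_add' f g := by
    ext1 o
    cases o with
    | none => rfl
    | some i =>
      change (∂_{stdVec i} (f + g) : SchwartzVec d m).toLp 2 volume = _
      rw [LineDeriv.lineDerivOp_add]
      rfl
  map_smul' c f := by
    ext1 o
    cases o with
    | none => rfl
    | some i =>
      change (∂_{stdVec i} (c • f) : SchwartzVec d m).toLp 2 volume = _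
      rw [LineDeriv.lineDerivOp_smul]
      rfl

lemma schwartzGraph_none (f : SchwartzVec d m) :
    schwartzGraph d m f none = f.toLp 2 volume := rfl

lemma schwartzGraph_some (f : SchwartzVec d m) (i : Fin d) :
    schwartzGraph d m f (some i) = (∂_{stdVec i} f : SchwartzVec d m).toLp 2 volume := rfl

lemma schwartzGraph_mem (f : SchwartzVec d m) : schwartzGraph d m f ∈ sobolevGraph d m := by
  refine mem_sobolevGraph.2 fun i => ?_
  rw [schwartzGraph_none, schwartzGraph_some, Lp.toTemperedDistribution_toLp_eq,
    Lp.toTemperedDistribution_toLp_eq, TemperedDistribution.lineDerivOp_toTemperedDistributionCLM_eq]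

/-- The Schwartz function `φ e_k`. -/
noncomputable def testVector {φ : EuclideanSpace ℝ (Fin d) → ℝ} (hφ : ContDiff ℝ ∞ φ)
    (hφ' : HasCompactSupport φ) (k : Fin m) :
    SchwartzVec d m :=
  HasCompactSupport.toSchwartzMap (f := fun x => φ x • EuclideanSpace.single k (1 : ℂ))
    hφ'.smul_right (hφ.smul contDiff_const)

lemma inner_eq_integral_of_ae_eq_smul_single {η : EuclideanSpace ℝ (Fin d) → ℝ} (hη : Continuous η)
    (hη' : HasCompactSupport η) {k : Fin m} {w : LTwo d m}
    (hw : w =ᵐ[volume] fun x => η x • EuclideanSpace.single k (1 : ℂ)) (u : LTwo d m) :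
    inner ℂ w u = (∫ x, η x • u x) k := by
  have hint := u.integrable_smul_of_hasCompactSupport hη hη'
  rw [eval_integral_piLp fun j => hint.eval_piLp j, L2.inner_def]
  refine integral_congr_ae ?_
  filter_upwards [hw] with x hx
  rw [hx, ← Complex.coe_smul, inner_smul_left, EuclideanSpace.inner_single_left]
  simp

lemma inner_testVector_none {φ : EuclideanSpace ℝ (Fin d) → ℝ} (hφ : ContDiff ℝ ∞ φ)
    (hφ' : HasCompactSupport φ) (k : Fin m) (u : LTwo d m) :
    inner ℂ (schwartzGraph d m (testVector hφ hφ' k) none) u = (∫ x, φ x • u x) k :=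
  inner_eq_integral_of_ae_eq_smul_single hφ.continuous hφ'
    ((testVector hφ hφ' k).coeFn_toLp 2 volume) u

lemma inner_testVector_some {φ : EuclideanSpace ℝ (Fin d) → ℝ} (hφ : ContDiff ℝ ∞ φ)
    (hφ' : HasCompactSupport φ) (k : Fin m) (i : Fin d) (u : LTwo d m) :
    inner ℂ (schwartzGraph d m (testVector hφ hφ' k) (some i)) u =
      (∫ x, fderiv ℝ φ x (stdVec i) • u x) k := by
  refine inner_eq_integral_of_ae_eq_smul_single (η := fun x => fderiv ℝ φ x (stdVec i))
    ((hφ.continuous_fderiv (by simp)).clm_apply continuous_const) (hφ'.fderiv_apply ℝ _) ?_ u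
  refine ((∂_{stdVec i} (testVector hφ hφ' k) : SchwartzVec d m).coeFn_toLp 2 volume).trans
    (.of_forall fun x => ?_)
  change fderiv ℝ (fun x => φ x • EuclideanSpace.single k (1 : ℂ)) x (stdVec i) = _
  rw [fderiv_smul_const (hφ.differentiable (by simp)).differentiableAt]
  rfl

lemma inner_testVector {φ : EuclideanSpace ℝ (Fin d) → ℝ} (hφ : ContDiff ℝ ∞ φ)
    (hφ' : HasCompactSupport φ) (k : Fin m) (p : GradientPair d m) :
    inner ℂ (schwartzGraph d m (testVector hφ hφ' k)) p =
      ((∫ x, φ x • p none x) + ∑ i, ∫ x, fderiv ℝ φ x (stdVec i) • p (some i) x) k := by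
  rw [PiLp.inner_apply, Fintype.sum_option, PiLp.add_apply, inner_testVector_none]
  simp [inner_testVector_some]

/-- A divergence relation is orthogonality to the graphs of the functions `φ e_k`; letting `k` vary
recovers the vector identity coordinatewise. -/
lemma isWeakDiv_iff_inner {p : GradientPair d m} :
    IsWeakDiv (fun i => p (some i)) (p none) ↔ ∀ (φ : EuclideanSpace ℝ (Fin d) → ℝ)
      (hφ : ContDiff ℝ ∞ φ) (hφ' : HasCompactSupport φ) (k : Fin m),
      inner ℂ (schwartzGraph d m (testVector hφ hφ' k)) p = 0 := by
  simp only [inner_testVector]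
  refine forall₃_congr fun φ hφ hφ' => ⟨fun h k => by rw [h]; rfl, fun h => ?_⟩
  ext k
  exact h k

/-- Test functions are dense in `H¹`: a weak divergence relation may be tested with `H¹`. -/
lemma IsWeakDiv.inner_eq_zero {q : GradientPair d m}
    (hq : IsWeakDiv (fun i => q (some i)) (q none)) {p : GradientPair d m}
    (hp : p ∈ sobolevGraph d m) : inner ℂ p q = 0 := by
  -- Only the projection `w` onto the graph matters. Graphs of test functions lie in that subspace,
  -- so `w` inherits the divergence relation; being of the form `(v, ∇v)`, it satisfies `Δv = v` and
  -- vanishes.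
  obtain ⟨w, hw, r, hr, rfl⟩ := (sobolevGraph d m).exists_add_mem_mem_orthogonal q
  have hw0 : IsWeakDiv (fun i => w (some i)) (w none) := isWeakDiv_iff_inner.2 fun φ hφ hφ' k => by
    have h1 := isWeakDiv_iff_inner.1 hq φ hφ hφ' k
    rwa [inner_add_right, (Submodule.mem_orthogonal _ _).1 hr _ (schwartzGraph_mem _),
      add_zero] at h1
  have h2 := hw0.temperedDistribution
  have h3 := mem_sobolevGraph.1 hw
  simp only [← h3] at h2
  have h4 : Lp.toTemperedDistribution (w none) =
      (0 : TemperedVec d m) := by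
    refine TemperedDistribution.eq_zero_of_laplacian_eq_self ?_
    rw [TemperedDistribution.laplacian_eq_sum (EuclideanSpace.basisFun (Fin d) ℝ)]
    simpa using h2
  have h0 : (0 : TemperedVec d m) =
      Lp.toTemperedDistribution (0 : LTwo d m) :=
    (map_zero (Lp.toTemperedDistributionCLM (EuclideanSpace ℂ (Fin m)) volume 2)).symm
  have h5 : w = 0 := by
    ext1 o
    cases o with
    | none => exact LTwo.toTemperedDistribution_injective (h4.trans h0)
    | some i =>
      refine LTwo.toTemperedDistribution_injective (((h3 i).symm.trans ?_).trans h0)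
      rw [h4]
      exact map_zero (LineDeriv.lineDerivOpCLM ℂ (TemperedVec d m) (stdVec i))
  rw [h5, zero_add]
  exact (Submodule.mem_orthogonal _ _).1 hr _ hp

/-! ### Identification of the graph with `H¹`. -/

/-- The distributional equation `∂_i u = g` as a relation between integrals. -/
lemma distPartial_eq_iff {i : Fin d} {u g : LTwo d m} :
    distPartial i (regularDistribution u) = regularDistribution g ↔ IsWeakDiv (Pi.single i u) g := by
  have hf : ∀ φ : 𝓓((⊤ : TopologicalSpace.Opens (EuclideanSpace ℝ (Fin d))), ℝ),
      distPartial i (regularDistribution u) φ = -∫ x, fderiv ℝ φ x (stdVec i) • u x := fun φ => by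
    rw [distPartial, Distribution.lineDerivOp_apply_apply, map_neg,
      regularDistribution_apply u.locallyIntegrable]
    rfl
  have hsum : ∀ φ : EuclideanSpace ℝ (Fin d) → ℝ,
      ∑ j, ∫ x, fderiv ℝ φ x (stdVec j) • (Pi.single i u : Fin d → LTwo d m) j x =
        ∫ x, fderiv ℝ φ x (stdVec i) • u x := fun φ => by
    rw [Finset.sum_eq_single i, Pi.single_eq_same]
    · intro j _ hj
      rw [Pi.single_eq_of_ne hj]
      refine integral_eq_zero_of_ae ?_
      filter_upwards [Lp.coeFn_zero (EuclideanSpace ℂ (Fin m)) 2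
        (volume : Measure (EuclideanSpace ℝ (Fin d)))] with x hx
      rw [hx, Pi.zero_apply, smul_zero]
    · simp
  constructor
  · intro h φ hφ hφ'
    have h1 := DFunLike.congr_fun h (⟨φ, hφ, hφ', fun _ _ => trivial⟩ :
      𝓓((⊤ : TopologicalSpace.Opens (EuclideanSpace ℝ (Fin d))), ℝ))
    rw [hf, regularDistribution_apply g.locallyIntegrable] at h1
    rw [hsum]
    exact (congrArg (· + _) h1.symm).trans (neg_add_cancel _)
  · intro h
    ext1 φ
    have h1 := h φ φ.contDiff φ.hasCompactSupport
    rw [hsum, add_eq_zero_iff_eq_neg] at h1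
    rw [hf, regularDistribution_apply g.locallyIntegrable, h1]

lemma isWeakDiv_single_iff {i : Fin d} {u g : LTwo d m} :
    IsWeakDiv (Pi.single i u) g ↔
      ∂_{stdVec i} (Lp.toTemperedDistribution u :
      TemperedVec d m) = Lp.toTemperedDistribution g := by
  have hsum : ∑ j, ∂_{stdVec j} (Lp.toTemperedDistribution ((Pi.single i u : Fin d → LTwo d m) j) :
      TemperedVec d m) = ∂_{stdVec i} (Lp.toTemperedDistribution u : TemperedVec d m) := by
    rw [Finset.sum_eq_single i, Pi.single_eq_same]
    · intro j _ hj
      rw [Pi.single_eq_of_ne hj]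
      exact map_zero (LineDeriv.lineDerivOpCLM ℂ (TemperedVec d m) (stdVec j) ∘L
        Lp.toTemperedDistributionCLM (EuclideanSpace ℂ (Fin m)) volume 2)
    · simp
  rw [isWeakDiv_iff_temperedDistribution, hsum]

/-- The pair `(u, ∇u)` of `u ∈ H¹`. -/
noncomputable def gradientPair (u : HOne d m) : GradientPair d m :=
  WithLp.toLp 2 fun o => o.elim (u : LTwo d m) fun i => weakPartial i u

lemma gradientPair_none (u : HOne d m) : gradientPair u none = (u : LTwo d m) := rfl

lemma gradientPair_some (u : HOne d m) (i : Fin d) : gradientPair u (some i) = weakPartial i u :=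
  rfl

lemma gradientPair_mem (u : HOne d m) : gradientPair u ∈ sobolevGraph d m :=
  mem_sobolevGraph.2 fun i =>
    isWeakDiv_single_iff.1 (distPartial_eq_iff.1 (regularDistribution_weakPartial i u).symm)

lemma exists_gradientPair_eq {p : GradientPair d m} (hp : p ∈ sobolevGraph d m) :
    ∃ u : HOne d m, gradientPair u = p := by
  have h1 : ∀ i, distPartial i (regularDistribution (p none)) = regularDistribution (p (some i)) :=
    fun i => distPartial_eq_iff.2 (isWeakDiv_single_iff.2 (mem_sobolevGraph.1 hp i))
  let u : HOne d m := ⟨p none, fun i => ⟨_, h1 i⟩⟩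
  refine ⟨u, PiLp.ext fun o => ?_⟩
  cases o with
  | none => rfl
  | some i =>
    rw [gradientPair_some]
    exact LTwo.regularDistribution_injective ((regularDistribution_weakPartial i u).trans (h1 i))

end WeakDivergence

/-! ### Solvability of the resolvent equation -/

/-- Lions' projection lemma. -/
lemma exists_inner_eq_of_coercive {G Φ : Type*} [NormedAddCommGroup G] [InnerProductSpace ℂ G]
    [AddCommGroup Φ] [Module ℂ Φ] (S : Submodule ℂ G) [CompleteSpace S] (j K : Φ →ₗ[ℂ] G)
    (hj : ∀ φ, j φ ∈ S) {c : ℝ} (hc : 0 < c) (hK : ∀ φ, c * ‖j φ‖ ^ 2 ≤ (inner ℂ (j φ) (K φ)).re)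
    (f : G) : ∃ u ∈ S, ∀ φ, inner ℂ (K φ) u = inner ℂ (j φ) f := by
  -- Only the projection of `K φ` to `S` is seen by elements of `S`, and coercivity bounds it below
  -- by `c‖j φ‖`.
  let K' : Φ →ₗ[ℂ] S := S.orthogonalProjectionOnto.toLinearMap ∘ₗ K
  have hK' : ∀ (v : S) φ, inner ℂ v (K' φ) = inner ℂ (v : G) (K φ) := fun v φ =>
    Submodule.inner_orthogonalProjectionOnto_eq_of_mem_left v (K φ)
  have hle : ∀ φ, c * ‖j φ‖ ≤ ‖K' φ‖ := fun φ => by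
    rcases eq_or_ne (j φ) 0 with h0 | h0
    · simp [h0]
    have h1 := hK φ
    rw [← hK' ⟨j φ, hj φ⟩] at h1
    have h2 := (Complex.re_le_norm _).trans (norm_inner_le_norm (𝕜 := ℂ) (⟨j φ, hj φ⟩ : S) (K' φ))
    rw [Submodule.coe_norm] at h2
    refine le_of_mul_le_mul_left ?_ (norm_pos_iff.2 h0)
    calc ‖j φ‖ * (c * ‖j φ‖) = c * ‖j φ‖ ^ 2 := by ring
      _ ≤ _ := h1.trans h2
  let ℓ : Φ →ₗ[ℂ] ℂ := (innerSL ℂ f).toLinearMap ∘ₗ j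
  have hℓ : ∀ φ, ‖ℓ φ‖ ≤ ‖f‖ / c * ‖K' φ‖ := fun φ => by
    refine (norm_inner_le_norm (𝕜 := ℂ) f (j φ)).trans ?_
    rw [div_mul_eq_mul_div, le_div_iff₀ hc, mul_assoc, mul_comm ‖j φ‖]
    gcongr
    exact hle φ
  have hker : LinearMap.ker K' ≤ LinearMap.ker ℓ := fun φ hφ => by
    have := hℓ φ
    rw [LinearMap.mem_ker.1 hφ, norm_zero, mul_zero] at this
    exact norm_le_zero_iff.1 this
  -- The functional `K' φ ↦ ⟨f, j φ⟩` is well defined and bounded by the lower bound on `K'`.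
  -- Hahn–Banach extends it to `S`, and Riesz represents it by the solution `u`.
  let g : LinearMap.range K' →ₗ[ℂ] ℂ :=
    (LinearMap.ker K').liftQ ℓ hker ∘ₗ K'.quotKerEquivRange.symm.toLinearMap
  have hg : ∀ φ, g ⟨K' φ, LinearMap.mem_range_self K' φ⟩ = ℓ φ := fun φ => by
    have : K'.quotKerEquivRange.symm ⟨K' φ, LinearMap.mem_range_self K' φ⟩ =
        (LinearMap.ker K').mkQ φ := LinearMap.quotKerEquivRange_symm_apply_image K' φ _
    simp only [g, LinearMap.comp_apply, LinearEquiv.coe_coe, this]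
    exact Submodule.liftQ_apply _ _ _
  obtain ⟨G', hG', -⟩ := exists_extension_norm_eq (𝕜 := ℂ) (LinearMap.range K')
    (g.mkContinuous (‖f‖ / c) fun y => by
      obtain ⟨_, φ, rfl⟩ := y
      rw [hg]
      exact hℓ φ)
  refine ⟨(InnerProductSpace.toDual ℂ S).symm G', Subtype.property _, fun φ => ?_⟩
  rw [← inner_conj_symm, ← hK', InnerProductSpace.toDual_symm_apply]
  have := hG' ⟨K' φ, LinearMap.mem_range_self K' φ⟩
  rw [LinearMap.mkContinuous_apply, hg] at this
  simp only at this
  rw [this]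
  exact inner_conj_symm _ _

section Resolvent

open scoped SchwartzMap ContDiff

variable {d m : ℕ}

/-! ### Multiplication operators and pointwise positivity. -/

/-- A bounded continuous function on `ℝ^d`. -/
structure IsBoundedContinuous (q : EuclideanSpace ℝ (Fin d) → ℝ) : Prop where
  continuous : Continuous q
  bounded : ∃ C, ∀ x, |q x| ≤ C

lemma IsBoundedContinuous.memLp_smul {q : EuclideanSpace ℝ (Fin d) → ℝ}
    (hq : IsBoundedContinuous q) (u : LTwo d m) : MemLp (fun x => q x • u x) 2 volume := by
  obtain ⟨C, hC⟩ := hq.bounded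
  have h : MemLp q ∞ volume :=
    memLp_top_of_bound hq.continuous.aestronglyMeasurable C (.of_forall hC)
  exact (Lp.memLp u).smul h

/-- Multiplication by a bounded continuous function on `L²`. -/
noncomputable def boundedMul {q : EuclideanSpace ℝ (Fin d) → ℝ} (hq : IsBoundedContinuous q) :
    LTwo d m →ₗ[ℂ] LTwo d m where
  toFun u := (hq.memLp_smul u).toLp
  map_add' u v := by
    rw [← MemLp.toLp_add]
    refine MemLp.toLp_congr _ _ ?_
    filter_upwards [Lp.coeFn_add u v] with x hx
    rw [hx, Pi.add_apply, smul_add]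
    rfl
  map_smul' c u := by
    rw [RingHom.id_apply, ← MemLp.toLp_const_smul]
    refine MemLp.toLp_congr _ _ ?_
    filter_upwards [Lp.coeFn_smul c u] with x hx
    rw [hx, Pi.smul_apply, smul_comm]
    rfl

lemma coeFn_boundedMul {q : EuclideanSpace ℝ (Fin d) → ℝ} (hq : IsBoundedContinuous q)
    (u : LTwo d m) : boundedMul hq u =ᵐ[volume] fun x => q x • u x :=
  (hq.memLp_smul u).coeFn_toLp

/-- Only the values of `V` on a ball containing the support of `w` matter, and there its entries are
essentially bounded. -/
lemma memLp_potentialMul {V : EuclideanSpace ℝ (Fin d) → Matrix (Fin m) (Fin m) ℝ}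
    (hV : ∀ i j, MemLinftyLoc fun x => V x i j)
    {w : EuclideanSpace ℝ (Fin d) → EuclideanSpace ℂ (Fin m)} (hw : MemLp w 2 volume)
    (hw' : HasCompactSupport w) : MemLp (potentialMul V w) 2 volume := by
  obtain ⟨r, hr, hKr⟩ := hw'.isCompact.isBounded.subset_closedBall_lt 0 0
  refine MemLp.of_eval_piLp fun i => ?_
  refine memLp_finsetSum (f := fun j x => (V x i j : ℂ) * w x j) Finset.univ fun j _ => ?_
  have h1 : MemLp (fun x => (((Metric.closedBall 0 r).indicator (fun x => V x i j) x : ℝ) : ℂ)) ∞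
      volume := (hV i j r hr).ofReal
  have h2 : MemLp (fun x => w x j) 2 volume := hw.eval_piLp j
  refine (memLp_congr_ae (.of_forall fun x => ?_)).1 (h2.mul h1 (r := 2))
  by_cases hx : x ∈ Metric.closedBall 0 r
  · simp [Set.indicator_of_mem hx]
  · have : w x = 0 := image_eq_zero_of_notMem_tsupport fun h => hx (hKr h)
    simp [this]


lemma inner_boundedMul {q : EuclideanSpace ℝ (Fin d) → ℝ} (hq : IsBoundedContinuous q)
    (u v : LTwo d m) : inner ℂ (boundedMul hq u) v = inner ℂ u (boundedMul hq v) := by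
  rw [L2.inner_def, L2.inner_def]
  refine integral_congr_ae ?_
  filter_upwards [coeFn_boundedMul hq u, coeFn_boundedMul hq v] with x hx hx'
  rw [hx, hx', ← Complex.coe_smul, ← Complex.coe_smul, inner_smul_left, inner_smul_right,
    Complex.conj_ofReal]

lemma LTwo.re_inner (u v : LTwo d m) :
    (inner ℂ u v).re = ∫ x, (inner ℂ (u x) (v x)).re := by
  rw [L2.inner_def]
  exact (integral_re (L2.integrable_inner (𝕜 := ℂ) u v)).symm

lemma LTwo.integrable_re_inner (u v : LTwo d m) :
    Integrable fun x => (inner ℂ (u x) (v x)).re :=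
  (L2.integrable_inner (𝕜 := ℂ) u v).re

variable {Q : EuclideanSpace ℝ (Fin d) → Matrix (Fin d) (Fin d) ℝ}
  {V : EuclideanSpace ℝ (Fin d) → Matrix (Fin m) (Fin m) ℝ}

namespace SchrodingerHypotheses

lemma isBoundedContinuous (h : SchrodingerHypotheses Q V) (i j : Fin d) :
    IsBoundedContinuous fun x => Q x i j :=
  ⟨(h.contDiff i j).continuous, h.bounded i j⟩

/-- Ellipticity for complex vectors. -/
lemma exists_elliptic_complex (h : SchrodingerHypotheses Q V) : ∃ η : ℝ, 0 < η ∧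
    ∀ x (a : Fin d → EuclideanSpace ℂ (Fin m)),
      η * ∑ i, ‖a i‖ ^ 2 ≤ ∑ i, ∑ j, Q x i j * (inner ℂ (a i) (a j)).re := by
  obtain ⟨η, _, hη, -, hQ⟩ := h.elliptic
  refine ⟨η, hη, fun x a => ?_⟩
  -- Real ellipticity is applied separately to the real and imaginary parts of each of the `m`
  -- components, and the results are added.
  have hsum : ∀ b : Fin d → ℝ, η * ∑ i, b i ^ 2 ≤ ∑ i, ∑ j, Q x i j * b i * b j := fun b => by
    have := (hQ x (WithLp.toLp 2 b)).1
    rwa [EuclideanSpace.real_norm_sq_eq] at this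
  have h1 : ∀ i, ‖a i‖ ^ 2 = ∑ k, ((a i k).re ^ 2 + (a i k).im ^ 2) := fun i => by
    rw [EuclideanSpace.norm_sq_eq]
    refine Finset.sum_congr rfl fun k _ => ?_
    rw [Complex.sq_norm, Complex.normSq_apply]
    ring
  have h2 : ∀ i j, (inner ℂ (a i) (a j)).re =
      ∑ k, ((a i k).re * (a j k).re + (a i k).im * (a j k).im) := fun i j => by
    rw [PiLp.inner_apply, Complex.re_sum]
    refine Finset.sum_congr rfl fun k _ => ?_
    simp [RCLike.inner_apply]
    ring
  calc η * ∑ i, ‖a i‖ ^ 2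
      = ∑ k, (η * ∑ i, (a i k).re ^ 2 + η * ∑ i, (a i k).im ^ 2) := by
        simp only [h1]
        rw [Finset.sum_comm, Finset.mul_sum]
        simp only [Finset.sum_add_distrib, mul_add]
    _ ≤ ∑ k, ((∑ i, ∑ j, Q x i j * (a i k).re * (a j k).re) +
          ∑ i, ∑ j, Q x i j * (a i k).im * (a j k).im) :=
        Finset.sum_le_sum fun k _ => add_le_add (hsum _) (hsum _)
    _ = ∑ i, ∑ j, Q x i j * (inner ℂ (a i) (a j)).re := by
        simp only [h2, ← Finset.sum_add_distrib]
        rw [Finset.sum_comm]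
        refine Finset.sum_congr rfl fun i _ => ?_
        rw [Finset.sum_comm]
        refine Finset.sum_congr rfl fun j _ => ?_
        rw [Finset.mul_sum]
        refine Finset.sum_congr rfl fun k _ => ?_
        ring

lemma accretive_inner (h : SchrodingerHypotheses Q V) (x : EuclideanSpace ℝ (Fin d))
    (w : EuclideanSpace ℝ (Fin d) → EuclideanSpace ℂ (Fin m)) :
    0 ≤ (inner ℂ (w x) (potentialMul V w x)).re := by
  refine (h.accretive x (w x)).trans_eq ?_
  rw [PiLp.inner_apply]
  congr 1
  refine Finset.sum_congr rfl fun i _ => ?_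
  simp only [potentialMul, RCLike.inner_apply, Finset.sum_mul]

/-- For real `V`, transposition conjugates the quadratic form at the same vector and so leaves its
real part unchanged. -/
lemma accretive_inner_transpose (h : SchrodingerHypotheses Q V) (x : EuclideanSpace ℝ (Fin d))
    (w : EuclideanSpace ℝ (Fin d) → EuclideanSpace ℂ (Fin m)) :
    0 ≤ (inner ℂ (w x) (potentialMul (fun x => (V x).transpose) w x)).re := by
  refine (h.accretive x (w x)).trans_eq ?_
  rw [PiLp.inner_apply, ← Complex.conj_re]
  congr 1
  rw [map_sum, Finset.sum_congr rfl fun i _ => map_sum _ _ _, Finset.sum_comm]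
  refine Finset.sum_congr rfl fun i _ => ?_
  simp only [potentialMul, RCLike.inner_apply, Finset.sum_mul, map_mul, Complex.conj_ofReal,
    Complex.conj_conj, Matrix.transpose_apply]
  exact Finset.sum_congr rfl fun j _ => by ring

/-- The flux `Q∇u` as an `L²` function. -/
noncomputable def fluxLp (h : SchrodingerHypotheses Q V) (i : Fin d) :
    GradientPair d m →ₗ[ℂ] LTwo d m :=
  ∑ j, boundedMul (h.isBoundedContinuous i j) ∘ₗ PiLp.projₗ 2 (fun _ => LTwo d m) (some j)

lemma fluxLp_apply (h : SchrodingerHypotheses Q V) (i : Fin d) (p : GradientPair d m) :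
    h.fluxLp i p = ∑ j, boundedMul (h.isBoundedContinuous i j) (p (some j)) := by
  simp [fluxLp]

lemma coeFn_fluxLp (h : SchrodingerHypotheses Q V) (i : Fin d) (p : GradientPair d m) :
    h.fluxLp i p =ᵐ[volume] fun x => ∑ j, Q x i j • p (some j) x := by
  rw [fluxLp_apply]
  have h1 : ∀ᵐ x, ∀ j, boundedMul (h.isBoundedContinuous i j) (p (some j)) x =
      Q x i j • p (some j) x := ae_all_iff.2 fun j => coeFn_boundedMul _ _
  filter_upwards [h1, Lp.coeFn_finsetSum Finset.univ fun j =>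
    boundedMul (h.isBoundedContinuous i j) (p (some j))] with x hx hx'
  rw [hx', Finset.sum_apply]
  simp only [hx]

/-- The equation `𝒜u = f` as a relation between integrals. -/
lemma isRealization_iff (h : SchrodingerHypotheses Q V) {u : HOne d m} {f : LTwo d m} :
    IsRealization Q V (u : LTwo d m) f ↔ ∀ η : EuclideanSpace ℝ (Fin d) → ℝ, ContDiff ℝ ∞ η →
      HasCompactSupport η → (∫ x, η x • f x) + (∫ x, η x • potentialMul V (u : LTwo d m) x) +
        ∑ i, ∫ x, fderiv ℝ η x (stdVec i) • h.fluxLp i (gradientPair u) x = 0 := by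
  have hflux : ∀ i, flux Q u i =ᵐ[volume] h.fluxLp i (gradientPair u) := fun i =>
    (h.coeFn_fluxLp i (gradientPair u)).symm
  have key : ∀ φ : 𝓓((⊤ : TopologicalSpace.Opens (EuclideanSpace ℝ (Fin d))), ℝ),
      schrodingerDistribution Q V u φ = regularDistribution f φ ↔
      (∫ x, φ x • f x) + (∫ x, φ x • potentialMul V (u : LTwo d m) x) +
        ∑ i, ∫ x, fderiv ℝ φ x (stdVec i) • h.fluxLp i (gradientPair u) x = 0 := fun φ => by
    have h1 : ∀ i, distPartial i (regularDistribution (flux Q u i)) φ =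
        -∫ x, fderiv ℝ φ x (stdVec i) • h.fluxLp i (gradientPair u) x := fun i => by
      rw [regularDistribution_congr (h.flux_locallyIntegrable u i) (hflux i), distPartial,
        Distribution.lineDerivOp_apply_apply, map_neg,
        regularDistribution_apply (LTwo.locallyIntegrable _)]
      rfl
    rw [schrodingerDistribution, _root_.sub_apply, deltaQ, _root_.sum_apply,
      regularDistribution_apply (h.potentialMul_locallyIntegrable _),
      regularDistribution_apply f.locallyIntegrable]
    simp only [h1, Finset.sum_neg_distrib]
    rw [add_assoc, add_eq_zero_iff_eq_neg, eq_comm, neg_add_rev, ← sub_eq_add_neg]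
  constructor
  · rintro ⟨hu, hf⟩ η hη hη'
    exact (key ⟨η, hη, hη', fun _ _ => trivial⟩).1 (DFunLike.congr_fun hf _)
  · intro hη
    refine ⟨u.2, ?_⟩
    ext1 φ
    exact (key φ).2 (hη φ φ.contDiff φ.hasCompactSupport)

end SchrodingerHypotheses

/-! ### The form of `c - 𝒜` on test functions and the resolvent equation. -/

/-- The smooth compactly supported functions with values in `ℂ^m`. -/
noncomputable def testSpace (d m : ℕ) : Submodule ℂ (SchwartzVec d m) where
  carrier := {f | HasCompactSupport f}
  zero_mem' := HasCompactSupport.zero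
  add_mem' := fun hf hg => HasCompactSupport.add hf hg
  smul_mem' := fun c _ hf => HasCompactSupport.smul_left (f := fun _ => c) hf

namespace SchrodingerHypotheses

lemma memLp_transpose (h : SchrodingerHypotheses Q V) (φ : testSpace d m) :
    MemLp (potentialMul (fun x => (V x).transpose) (φ : SchwartzVec d m)) 2 volume :=
  memLp_potentialMul (fun i j => h.locallyBounded j i) ((φ : SchwartzVec d m).memLp 2) φ.2

/-- The map `φ ↦ Vᵀφ` on test functions. -/
noncomputable def transposeMul (h : SchrodingerHypotheses Q V) : testSpace d m →ₗ[ℂ] LTwo d m where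
  toFun φ := (h.memLp_transpose φ).toLp
  map_add' φ ψ := by
    rw [← MemLp.toLp_add]
    exact MemLp.toLp_congr _ _ (.of_forall fun x => congrFun (potentialMul_add _ _) x)
  map_smul' c φ := by
    rw [RingHom.id_apply, ← MemLp.toLp_const_smul]
    exact MemLp.toLp_congr _ _ (.of_forall fun x => congrFun (potentialMul_smul _ _) x)

lemma coeFn_transposeMul (h : SchrodingerHypotheses Q V) (φ : testSpace d m) :
    h.transposeMul φ =ᵐ[volume] potentialMul (fun x => (V x).transpose) (φ : SchwartzVec d m) :=
  (h.memLp_transpose φ).coeFn_toLp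

/-- `φ ↦ (cφ + Vᵀφ, Qᵀ∇φ)`, which represents the form of `c - 𝒜` on `H¹ × C_c^∞`. -/
noncomputable def formOperator (h : SchrodingerHypotheses Q V) (c : ℝ) :
    testSpace d m →ₗ[ℂ] GradientPair d m :=
  (WithLp.linearEquiv 2 ℂ (Option (Fin d) → LTwo d m)).symm.toLinearMap ∘ₗ
    LinearMap.pi fun o => o.elim
      ((c : ℂ) • (PiLp.projₗ 2 (fun _ => LTwo d m) none ∘ₗ schwartzGraph d m ∘ₗ
        (testSpace d m).subtype) + h.transposeMul)
      fun j => ∑ i, boundedMul (h.isBoundedContinuous i j) ∘ₗ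
        PiLp.projₗ 2 (fun _ => LTwo d m) (some i) ∘ₗ schwartzGraph d m ∘ₗ (testSpace d m).subtype

lemma formOperator_none (h : SchrodingerHypotheses Q V) (c : ℝ) (φ : testSpace d m) :
    h.formOperator c φ none = (c : ℂ) • schwartzGraph d m φ none + h.transposeMul φ := rfl

lemma formOperator_some (h : SchrodingerHypotheses Q V) (c : ℝ) (φ : testSpace d m) (j : Fin d) :
    h.formOperator c φ (some j) =
      ∑ i, boundedMul (h.isBoundedContinuous i j) (schwartzGraph d m φ (some i)) := by
  change (∑ i, boundedMul (h.isBoundedContinuous i j) ∘ₗ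
        PiLp.projₗ 2 (fun _ => LTwo d m) (some i) ∘ₗ schwartzGraph d m ∘ₗ
          (testSpace d m).subtype) φ = _
  rw [LinearMap.sum_apply]
  rfl

/-- The potential contributes a nonnegative term, `c` controls the `L²` norm, and ellipticity
controls the gradient; hence the constant `min c η`. -/
lemma exists_coercive (h : SchrodingerHypotheses Q V) {c : ℝ} (hc : 0 < c) : ∃ η : ℝ, 0 < η ∧
    ∀ φ : testSpace d m, η * ‖schwartzGraph d m φ‖ ^ 2 ≤
      (inner ℂ (schwartzGraph d m φ) (h.formOperator c φ)).re := by
  obtain ⟨η, hη, hQ⟩ := h.exists_elliptic_complex (m := m)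
  refine ⟨min c η, lt_min hc hη, fun φ => ?_⟩
  set p := schwartzGraph d m φ with hp
  have h1 : 0 ≤ (inner ℂ (p none) (h.transposeMul φ)).re := by
    rw [LTwo.re_inner]
    refine integral_nonneg_of_ae ?_
    filter_upwards [h.coeFn_transposeMul φ, (φ : SchwartzVec d m).coeFn_toLp 2 volume] with x hx hx'
    rw [hx, hp, schwartzGraph_none, hx']
    exact h.accretive_inner_transpose x _
  have h2 : η * ∑ i, ‖p (some i)‖ ^ 2 ≤ ∑ j, (inner ℂ (p (some j))
      (h.formOperator c φ (some j))).re := by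
    have e1 : ∀ j, (inner ℂ (p (some j)) (h.formOperator c φ (some j))).re =
        ∑ i, ∫ x, Q x i j * (inner ℂ (p (some i) x) (p (some j) x)).re := fun j => by
      rw [formOperator_some, inner_sum, Complex.re_sum]
      refine Finset.sum_congr rfl fun i _ => ?_
      rw [LTwo.re_inner]
      refine integral_congr_ae ?_
      filter_upwards [coeFn_boundedMul (h.isBoundedContinuous i j) (p (some i))] with x hx
      rw [hx, ← Complex.coe_smul, inner_smul_right, Complex.re_ofReal_mul,
        ← inner_conj_symm, Complex.conj_re]
    have hint : ∀ i j, Integrable fun x => Q x i j * (inner ℂ (p (some i) x) (p (some j) x)).re :=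
      fun i j => by
      refine (LTwo.integrable_re_inner (boundedMul (h.isBoundedContinuous i j) (p (some i)))
        (p (some j))).congr ?_
      filter_upwards [coeFn_boundedMul (h.isBoundedContinuous i j) (p (some i))] with x hx
      rw [hx, ← Complex.coe_smul, inner_smul_left, Complex.conj_ofReal, Complex.re_ofReal_mul]
    have e2 : ∀ i, ‖p (some i)‖ ^ 2 = ∫ x, ‖p (some i) x‖ ^ 2 := fun i => by
      rw [← inner_self_eq_norm_sq (𝕜 := ℂ), RCLike.re_eq_complex_re, LTwo.re_inner]
      exact integral_congr_ae (.of_forall fun x => inner_self_eq_norm_sq (𝕜 := ℂ) _)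
    have hint2 : ∀ i, Integrable fun x => ‖p (some i) x‖ ^ 2 := fun i =>
      (LTwo.integrable_re_inner (p (some i)) (p (some i))).congr
        (.of_forall fun x => inner_self_eq_norm_sq (𝕜 := ℂ) _)
    simp only [e1, e2]
    rw [Finset.sum_comm, ← integral_finsetSum _ fun i _ => hint2 i, ← integral_const_mul]
    simp only [← integral_finsetSum Finset.univ fun j _ => hint _ j]
    rw [← integral_finsetSum _ fun i _ => integrable_finsetSum _ fun j _ => hint i j]
    exact integral_mono ((integrable_finsetSum _ fun i _ => hint2 i).const_mul η)
      (integrable_finsetSum _ fun i _ => integrable_finsetSum _ fun j _ => hint i j)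
      fun x => hQ x fun i => p (some i) x
  have h3 : (inner ℂ p (h.formOperator c φ)).re = c * ‖p none‖ ^ 2 +
      (inner ℂ (p none) (h.transposeMul φ)).re +
        ∑ j, (inner ℂ (p (some j)) (h.formOperator c φ (some j))).re := by
    rw [PiLp.inner_apply, Fintype.sum_option, formOperator_none, inner_add_right, inner_smul_right,
      inner_self_eq_norm_sq_to_K, Complex.add_re, Complex.add_re, Complex.re_sum,
      Complex.re_ofReal_mul]
    norm_cast
  have h4 : ‖p‖ ^ 2 = ‖p none‖ ^ 2 + ∑ i, ‖p (some i)‖ ^ 2 := by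
    rw [PiLp.norm_sq_eq_of_L2, Fintype.sum_option]
  rw [h3, h4, mul_add]
  have h5 : min c η * ‖p none‖ ^ 2 ≤ c * ‖p none‖ ^ 2 := by gcongr; exact min_le_left _ _
  have h6 : min c η * ∑ i, ‖p (some i)‖ ^ 2 ≤ η * ∑ i, ‖p (some i)‖ ^ 2 := by
    gcongr; exact min_le_right _ _
  linarith

/-- Transposing moves `V` from `u` to the test vector; `V` and `φ` are real, so the conjugation in
the inner product has no effect. This turns the abstract solution back into the distributional
equation. -/
lemma inner_transposeMul (h : SchrodingerHypotheses Q V) {φ : EuclideanSpace ℝ (Fin d) → ℝ}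
    (hφ : ContDiff ℝ ∞ φ) (hφ' : HasCompactSupport φ) (k : Fin m)
    (hmem : testVector hφ hφ' k ∈ testSpace d m) (u : LTwo d m) :
    inner ℂ (h.transposeMul ⟨_, hmem⟩) u = (∫ x, φ x • potentialMul V u x) k := by
  have hint : Integrable fun x => φ x • potentialMul V u x :=
    (h.potentialMul_locallyIntegrable u).integrable_smul_left_of_hasCompactSupport
      hφ.continuous hφ'
  rw [eval_integral_piLp fun j => hint.eval_piLp j, L2.inner_def]
  refine integral_congr_ae ?_
  filter_upwards [h.coeFn_transposeMul ⟨_, hmem⟩] with x hx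
  rw [hx, PiLp.inner_apply]
  have h1 : ∀ i, potentialMul (fun x => (V x).transpose) (testVector hφ hφ' k) x i =
      ((V x k i * φ x : ℝ) : ℂ) := fun i => by
    change ∑ j, ((V x).transpose i j : ℂ) * ((φ x • EuclideanSpace.single k (1 : ℂ) :
      EuclideanSpace ℂ (Fin m)) j) = _
    rw [Finset.sum_eq_single k]
    · simp
    · intro j _ hj
      simp [hj]
    · simp
  have h2 : (φ x • potentialMul V u x) k = φ x * ∑ j, (V x k j : ℂ) * u x j := by
    simp [potentialMul]
  rw [h2, Finset.mul_sum]
  refine Finset.sum_congr rfl fun i _ => ?_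
  rw [h1, RCLike.inner_apply, Complex.conj_ofReal, Complex.ofReal_mul]
  ring

/-- The resolvent equation `cu - 𝒜u = f` is solvable. -/
theorem exists_isRealization (h : SchrodingerHypotheses Q V) {c : ℝ} (hc : 0 < c) (f : LTwo d m) :
    ∃ u : LTwo d m, IsRealization Q V u ((c : ℂ) • u - f) := by
  obtain ⟨η, hη, hcoer⟩ := h.exists_coercive hc
  let f' : GradientPair d m := WithLp.toLp 2 fun o => o.elim f fun _ => 0
  obtain ⟨p, hp, hsol⟩ := exists_inner_eq_of_coercive (sobolevGraph d m)
    (schwartzGraph d m ∘ₗ (testSpace d m).subtype) (h.formOperator c)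
    (fun φ => schwartzGraph_mem _) hη hcoer f'
  obtain ⟨u, rfl⟩ := exists_gradientPair_eq hp
  refine ⟨u, h.isRealization_iff.2 fun φ hφ hφ' => ?_⟩
  ext k
  have hmem : testVector hφ hφ' k ∈ testSpace d m := hφ'.smul_right
  have h1 := hsol ⟨_, hmem⟩
  rw [PiLp.inner_apply, PiLp.inner_apply, Fintype.sum_option, Fintype.sum_option,
    formOperator_none] at h1
  simp only [formOperator_some, LinearMap.comp_apply, Submodule.subtype_apply,
    sum_inner, inner_boundedMul] at h1
  have h2 : ∀ i, f' (some i) = 0 := fun i => rfl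
  have h3 : f' none = f := rfl
  rw [inner_add_left, inner_smul_left, Complex.conj_ofReal, h.inner_transposeMul, h3] at h1
  simp only [h2, inner_zero_right, Finset.sum_const_zero, add_zero] at h1
  -- With the real coefficients `q_ij` already moved onto `∂_j u`, exchanging the sums collects the
  -- inner sum over `j` into the flux.
  rw [Finset.sum_comm] at h1
  simp only [← inner_sum, gradientPair_none] at h1
  simp only [PiLp.add_apply, ← inner_testVector_none hφ hφ' k]
  have h4 : (∑ i, ∫ x, fderiv ℝ φ x (stdVec i) • h.fluxLp i (gradientPair u) x) k =
      ∑ i, inner ℂ (schwartzGraph d m (testVector hφ hφ' k) (some i))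
        (h.fluxLp i (gradientPair u)) := by
    simp [inner_testVector_some]
  rw [h4, inner_sub_right, inner_smul_right, ← h1, PiLp.zero_apply]
  simp only [h.fluxLp_apply]
  ring

end SchrodingerHypotheses

end Resolvent

/-! ### Dissipativity -/

section Dissipativity

open scoped ContDiff

variable {d m : ℕ}

lemma HasCompactSupport.isBoundedContinuous {q : EuclideanSpace ℝ (Fin d) → ℝ}
    (hq' : HasCompactSupport q) (hq : Continuous q) : IsBoundedContinuous q :=
  ⟨hq, hq'.exists_bound_of_continuous hq⟩

lemma LTwo.re_inner_boundedMul {q : EuclideanSpace ℝ (Fin d) → ℝ} (hq : IsBoundedContinuous q)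
    (u v : LTwo d m) : (inner ℂ u (boundedMul hq v)).re = ∫ x, q x * (inner ℂ (u x) (v x)).re := by
  rw [LTwo.re_inner]
  refine integral_congr_ae ?_
  filter_upwards [coeFn_boundedMul hq v] with x hx
  rw [hx, ← Complex.coe_smul, inner_smul_right, Complex.re_ofReal_mul]

/-- The pairing `u ↦ ∫ η u` with a test function `η`. -/
noncomputable def testIntegral {η : EuclideanSpace ℝ (Fin d) → ℝ} (hη : Continuous η)
    (hη' : HasCompactSupport η) : LTwo d m →ₗ[ℂ] EuclideanSpace ℂ (Fin m) where
  toFun u := ∫ x, η x • u x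
  map_add' u v := by
    rw [← integral_add (u.integrable_smul_of_hasCompactSupport hη hη')
      (v.integrable_smul_of_hasCompactSupport hη hη')]
    refine integral_congr_ae ?_
    filter_upwards [Lp.coeFn_add u v] with x hx
    rw [hx, Pi.add_apply, smul_add]
  map_smul' c u := by
    rw [RingHom.id_apply, ← integral_smul]
    refine integral_congr_ae ?_
    filter_upwards [Lp.coeFn_smul c u] with x hx
    rw [hx, Pi.smul_apply, smul_comm]

lemma testIntegral_apply {η : EuclideanSpace ℝ (Fin d) → ℝ} (hη : Continuous η)
    (hη' : HasCompactSupport η) (u : LTwo d m) : testIntegral hη hη' u = ∫ x, η x • u x := rfl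

lemma testIntegral_boundedMul {η q : EuclideanSpace ℝ (Fin d) → ℝ} (hη : Continuous η)
    (hη' : HasCompactSupport η) (hq : IsBoundedContinuous q) (u : LTwo d m) :
    testIntegral hη hη' (boundedMul hq u) = ∫ x, (q x * η x) • u x := by
  rw [testIntegral_apply]
  refine integral_congr_ae ?_
  filter_upwards [coeFn_boundedMul hq u] with x hx
  rw [hx, smul_smul, mul_comm]

/-- Integrals of `ζ_n` against an integrable function, for `ζ_n` bounded and eventually constant. -/
lemma tendsto_integral_mul_of_eventually_eq {ζ : ℕ → EuclideanSpace ℝ (Fin d) → ℝ} {C a : ℝ}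
    (hc : ∀ n, Continuous (ζ n)) (hC : ∀ n x, ‖ζ n x‖ ≤ C)
    (hlim : ∀ x, ∀ᶠ n in atTop, ζ n x = a) {g : EuclideanSpace ℝ (Fin d) → ℝ} (hg : Integrable g) :
    Tendsto (fun n => ∫ x, ζ n x * g x) atTop (𝓝 (a * ∫ x, g x)) := by
  rw [← integral_const_mul]
  refine tendsto_integral_of_dominated_convergence (fun x => C * ‖g x‖)
    (fun n => (hc n).aestronglyMeasurable.mul hg.aestronglyMeasurable) (hg.norm.const_mul C)
    (fun n => .of_forall fun x => ?_) (.of_forall fun x => ?_)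
  · rw [norm_mul]
    gcongr
    exact hC n x
  · refine tendsto_const_nhds.congr' ?_
    filter_upwards [hlim x] with n hn
    rw [hn]

namespace SchrodingerHypotheses

variable {Q : EuclideanSpace ℝ (Fin d) → Matrix (Fin d) (Fin d) ℝ}
  {V : EuclideanSpace ℝ (Fin d) → Matrix (Fin m) (Fin m) ℝ}

/-- `V` acts pointwise and linearly, so the cutoff may be moved onto `u`, which reduces the claim to
a compactly supported function. -/
lemma memLp_smul_potentialMul (h : SchrodingerHypotheses Q V)
    {ζ : EuclideanSpace ℝ (Fin d) → ℝ} (hζ : Continuous ζ) (hζ' : HasCompactSupport ζ)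
    (u : LTwo d m) : MemLp (fun x => ζ x • potentialMul V u x) 2 volume := by
  have h1 := memLp_potentialMul h.locallyBounded
    ((hζ'.isBoundedContinuous hζ).memLp_smul u) hζ'.smul_right
  refine (memLp_congr_ae (.of_forall fun x => ?_)).1 h1
  ext i
  simp [potentialMul, Finset.mul_sum, mul_left_comm]

/-- The equation `𝒜u = f` tested with `ζu` for a real cutoff function `ζ`. -/
lemma cutoff_identity (h : SchrodingerHypotheses Q V) {u : HOne d m} {f : LTwo d m}
    (hf : IsRealization Q V (u : LTwo d m) f) {ζ : EuclideanSpace ℝ (Fin d) → ℝ}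
    (hζ : ContDiff ℝ ∞ ζ) (hζ' : HasCompactSupport ζ) (hζ0 : ∀ x, 0 ≤ ζ x) :
    (∫ x, ζ x * (inner ℂ ((u : LTwo d m) x) (f x)).re) + ∑ i, ∫ x, fderiv ℝ ζ x (stdVec i) *
      (inner ℂ ((u : LTwo d m) x) (h.fluxLp i (gradientPair u) x)).re ≤ 0 := by
  have hζb : IsBoundedContinuous ζ := hζ'.isBoundedContinuous hζ.continuous
  have hdc : ∀ i, Continuous fun x => fderiv ℝ ζ x (stdVec i) := fun i =>
    (hζ.continuous_fderiv (by simp)).clm_apply continuous_const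
  have hdb : ∀ i, IsBoundedContinuous fun x => fderiv ℝ ζ x (stdVec i) := fun i =>
    (hζ'.fderiv_apply ℝ _).isBoundedContinuous (hdc i)
  let F : Fin d → LTwo d m := fun i => h.fluxLp i (gradientPair u)
  let W : LTwo d m := (h.memLp_smul_potentialMul hζ.continuous hζ' (u : LTwo d m)).toLp
  have hW : W =ᵐ[volume] fun x => ζ x • potentialMul V (u : LTwo d m) x :=
    (h.memLp_smul_potentialMul hζ.continuous hζ' (u : LTwo d m)).coeFn_toLp
  -- The product rule `div (ζF) = ζ div F + ∇ζ · F` with `div F = f + Vu`. Localizing the equation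
  -- instead of the test function keeps `Vu` in `L²` and allows pairing with `u` itself.
  let q : GradientPair d m := WithLp.toLp 2 fun o => o.elim
    (boundedMul hζb f + W + ∑ i, boundedMul (hdb i) (F i)) fun i => boundedMul hζb (F i)
  have hq : IsWeakDiv (fun i => q (some i)) (q none) := by
    intro η hη hη'
    have hηd : ∀ i, Continuous fun x => fderiv ℝ η x (stdVec i) := fun i =>
      (hη.continuous_fderiv (by simp)).clm_apply continuous_const
    -- For real smooth `η` the product `ζη` is an admissible test function; its gradient splits into
    -- the two flux terms of `q`.
    have h1 := h.isRealization_iff.1 hf (fun x => ζ x * η x) (hζ.mul hη) hζ'.mul_right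
    have h2 : (∫ x, η x • q none x) = testIntegral hη.continuous hη'
      (boundedMul hζb f + W + ∑ i, boundedMul (hdb i) (F i)) := rfl
    have h3 : ∀ i, (∫ x, fderiv ℝ η x (stdVec i) • q (some i) x) =
      testIntegral (hηd i) (hη'.fderiv_apply ℝ _) (boundedMul hζb (F i)) := fun i => rfl
    have h4 : testIntegral hη.continuous hη' W =
        ∫ x, (ζ x * η x) • potentialMul V (u : LTwo d m) x := by
      rw [testIntegral_apply]
      refine integral_congr_ae ?_
      filter_upwards [hW] with x hx
      rw [hx, smul_smul, mul_comm]
    have h5 : ∀ i, (∫ x, fderiv ℝ (fun x => ζ x * η x) x (stdVec i) • F i x) =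
        (∫ x, (fderiv ℝ ζ x (stdVec i) * η x) • F i x) +
          ∫ x, (ζ x * fderiv ℝ η x (stdVec i)) • F i x := fun i => by
      have hi1 : Integrable fun x => (fderiv ℝ ζ x (stdVec i) * η x) • F i x :=
        (F i).integrable_smul_of_hasCompactSupport ((hdc i).mul hη.continuous) hη'.mul_left
      have hi2 : Integrable fun x => (ζ x * fderiv ℝ η x (stdVec i)) • F i x :=
        (F i).integrable_smul_of_hasCompactSupport (hζ.continuous.mul (hηd i)) hζ'.mul_right
      rw [← integral_add hi1 hi2]
      refine integral_congr_ae (.of_forall fun x => ?_)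
      have : fderiv ℝ (fun x => ζ x * η x) x = _ :=
        fderiv_fun_mul (hζ.differentiable (by simp)).differentiableAt
          (hη.differentiable (by simp)).differentiableAt
      simp only [this, ← add_smul]
      congr 1
      simp only [_root_.add_apply, _root_.smul_apply, smul_eq_mul]
      ring
    simp only [h3, testIntegral_boundedMul]
    rw [h2, map_add, map_add, map_sum, h4]
    simp only [testIntegral_boundedMul]
    rw [Finset.sum_congr rfl fun i _ => h5 i, Finset.sum_add_distrib, ← add_assoc] at h1
    exact h1
  -- Density of test functions in `H¹` is used here: the relation is tested with `u`. The potential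
  -- and elliptic terms are then nonnegative and can be dropped.
  have h1 := congrArg Complex.re (hq.inner_eq_zero (gradientPair_mem u))
  have h2 : (inner ℂ (gradientPair u) q).re =
      (inner ℂ (u : LTwo d m) (boundedMul hζb f)).re + (inner ℂ (u : LTwo d m) W).re +
        ∑ i, (inner ℂ (u : LTwo d m) (boundedMul (hdb i) (F i))).re +
        ∑ i, (inner ℂ (weakPartial i u) (boundedMul hζb (F i))).re := by
    rw [PiLp.inner_apply, Fintype.sum_option, Complex.add_re, Complex.re_sum]
    change (inner ℂ (u : LTwo d m) (boundedMul hζb f + W + ∑ i, boundedMul (hdb i) (F i))).re + _ = _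
    rw [inner_add_right, inner_add_right, inner_sum, Complex.add_re, Complex.add_re, Complex.re_sum]
    rfl
  have h3 : 0 ≤ (inner ℂ (u : LTwo d m) W).re := by
    rw [LTwo.re_inner]
    refine integral_nonneg_of_ae ?_
    filter_upwards [hW] with x hx
    rw [hx, ← Complex.coe_smul, inner_smul_right, Complex.re_ofReal_mul]
    exact mul_nonneg (hζ0 x) (h.accretive_inner x _)
  have h4 : 0 ≤ ∑ i, (inner ℂ (weakPartial i u) (boundedMul hζb (F i))).re := by
    obtain ⟨c, hc, hQ⟩ := h.exists_elliptic_complex (m := m)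
    have hint : ∀ i, Integrable fun x =>
        (inner ℂ (weakPartial i u x) (boundedMul hζb (F i) x)).re := fun i =>
      LTwo.integrable_re_inner _ _
    simp only [LTwo.re_inner]
    rw [← integral_finsetSum _ fun i _ => hint i]
    refine integral_nonneg_of_ae ?_
    have hF : ∀ᵐ x, ∀ i, F i x = ∑ j, Q x i j • weakPartial j u x :=
      ae_all_iff.2 fun i => h.coeFn_fluxLp i (gradientPair u)
    have hB : ∀ᵐ x, ∀ i, boundedMul hζb (F i) x = ζ x • F i x :=
      ae_all_iff.2 fun i => coeFn_boundedMul hζb (F i)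
    filter_upwards [hF, hB] with x hx hx'
    have e : ∑ i, (inner ℂ (weakPartial i u x) (boundedMul hζb (F i) x)).re =
        ζ x * ∑ i, ∑ j, Q x i j * (inner ℂ (weakPartial i u x) (weakPartial j u x)).re := by
      rw [Finset.mul_sum]
      refine Finset.sum_congr rfl fun i _ => ?_
      rw [hx', hx, ← Complex.coe_smul, inner_smul_right, Complex.re_ofReal_mul, inner_sum,
        Complex.re_sum]
      congr 1
      refine Finset.sum_congr rfl fun j _ => ?_
      rw [← Complex.coe_smul, inner_smul_right, Complex.re_ofReal_mul]
    rw [Pi.zero_apply, e]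
    exact mul_nonneg (hζ0 x) ((by positivity : 0 ≤ c * ∑ i, ‖weakPartial i u x‖ ^ 2).trans
      (hQ x fun i => weakPartial i u x))
  rw [h2, Complex.zero_re] at h1
  simp only [LTwo.re_inner_boundedMul hζb (u : LTwo d m) f,
    fun i => LTwo.re_inner_boundedMul (hdb i) (u : LTwo d m) (F i)] at h1
  simp only [F] at h1 h4
  linarith

/-- The realization of `𝒜` in `L²` is dissipative. -/
theorem dissipative (h : SchrodingerHypotheses Q V) {u f : LTwo d m}
    (hf : IsRealization Q V u f) : (inner ℂ f u).re ≤ 0 := by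
  obtain ⟨u, rfl⟩ : ∃ v : HOne d m, (v : LTwo d m) = u := ⟨⟨u, hf.choose⟩, rfl⟩
  obtain ⟨ζ, C, hζ, hζc, hζ0, hζ1, hζC, hζlim⟩ := exists_cutoff d
  have hlim0 := tendsto_integral_mul_of_eventually_eq (C := 1) (a := 1)
    (fun n => (hζ n).continuous) (fun n x => by rw [Real.norm_of_nonneg (hζ0 n x)]; exact hζ1 n x)
    (fun x => (hζlim x).mono fun n hn => hn.self_of_nhds)
    (LTwo.integrable_re_inner (u : LTwo d m) f)
  -- The commutator terms tend to zero: the gradients of the cutoffs are bounded by `C` and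
  -- eventually vanish at each point, while `⟨u, Q∇u⟩` is integrable.
  have hlim1 := fun i => tendsto_integral_mul_of_eventually_eq (C := C) (a := 0)
    (ζ := fun n x => fderiv ℝ (ζ n) x (stdVec i))
    (fun n => ((hζ n).continuous_fderiv (by simp)).clm_apply continuous_const)
    (fun n x => ((fderiv ℝ (ζ n) x).le_opNorm _).trans (by simpa using hζC n x))
    (fun x => (hζlim x).mono fun n hn => by
      rw [hn.fderiv_eq]
      simp)
    (LTwo.integrable_re_inner (u : LTwo d m) (h.fluxLp i (gradientPair u)))
  have hlim := hlim0.add (tendsto_finsetSum Finset.univ fun i _ => hlim1 i)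
  have hle := le_of_tendsto hlim
    (.of_forall fun n => h.cutoff_identity hf (hζ n) (hζc n) (hζ0 n))
  simp only [zero_mul, Finset.sum_const_zero, add_zero, one_mul, ← LTwo.re_inner] at hle
  rwa [← inner_conj_symm, Complex.conj_re]

end SchrodingerHypotheses

end Dissipativity

/-! ### Generation by the Schrödinger operator. -/

theorem corollary3p3 {d m : ℕ} (hd : 1 ≤ d) (hm : 1 ≤ m)
    (Q : EuclideanSpace ℝ (Fin d) → Matrix (Fin d) (Fin d) ℝ)
    (V : EuclideanSpace ℝ (Fin d) → Matrix (Fin m) (Fin m) ℝ)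
    (h : SchrodingerHypotheses Q V) :
    ∃ T : ℝ≥0 → LTwo d m →L[ℂ] LTwo d m,
      IsC0Semigroup T ∧ (∀ t, ‖T t‖ ≤ 1) ∧
        semigroupGenerator T = schrodingerOperator Q V h := by
  have hspec : ∀ u : (schrodingerOperator Q V h).domain,
      IsRealization Q V (u : LTwo d m) (schrodingerOperator Q V h u) := fun u => u.2.choose_spec
  refine LinearPMap.exists_contractionSemigroup (fun u => h.dissipative (hspec u))
    fun c hc f => ?_
  obtain ⟨u, hu⟩ := h.exists_isRealization hc f
  refine ⟨⟨u, _, hu⟩, ?_⟩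
  rw [(hspec ⟨u, _, hu⟩).unique hu]
  exact sub_sub_cancel _ _
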